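/- An instance of MaxCDP (Maximum Colored Disjoint Paths) consists of a finite set $C$ of colors, a finite simple undirected graph $G=(V,E)$ with a map $f_C\colon E\to 2^C$ that assigns a set of colors to each edge, and two distinct vertices $s,t\in V$. A path is uni-color if some $c\in C$ is assigned to all of its edges, and two $st$-paths are disjoint if they share no vertex other than $s$ and $t$. The task is to compute the maximum number $\mathrm{opt}(I)$ of pairwise disjoint uni-color $st$-paths in $G$; in the decision version an integer $r\ge 0$ is also given, and the question is whether there exist at least $r$ such paths. Theorem. MaxCDP is fixed-parameter tractable when parameterized by the vertex cover number $\tau(G)$ (the minimum size of a vertex cover) of the input graph. That is, there are an algorithm, a computable function $f\colon\mathbb N\to\mathbb N$ and a constant $c$ such that the algorithm computes $\mathrm{opt}(I)$ for every instance $I$ in time at most $f(\tau(G))\cdot|I|^{c}$; and the same holds for the decision version. Here $|I|$ is the length of the encoding of the instance (in which $|V|$, $|C|$, $s$, $t$, the adjacency matrix of $G$ and, for each color, the adjacency matrix of the edges of that color are listed, followed, in the decision version, by $r$ in binary), and time is the number of steps of a random access machine with addition, truncated subtraction and halving at unit cost. -/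

import Mathlib

/-! ## Random access machines with unit cost -/

namespace RAM

/-- Instructions of a random access machine over `ℕ`. Registers are named by literals, memory cells
are addressed indirectly. The arithmetic is addition, truncated subtraction and halving. Without
unit-cost multiplication, `T` steps can only be simulated in time polynomial in `T` and the length
of the input by a Turing machine, and conversely. -/
inductive Instr where
  /-- `r_d := c` -/
  | const (d c : ℕ)
  /-- `r_d := r_a + r_b` -/
  | add (d a b : ℕ)
  /-- `r_d := max (r_a - r_b) 0` -/
  | sub (d a b : ℕ)
  /-- `r_d := ⌊r_a / 2⌋` -/
  | half (d a : ℕ)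
  /-- `r_d := mem[r_a]` -/
  | load (d a : ℕ)
  /-- `mem[r_a] := r_b` -/
  | store (a b : ℕ)
  /-- if `r_a = 0`, jump to instruction number `l` -/
  | jz (a l : ℕ)

/-- A program is a finite list of instructions. -/
abbrev Program := List Instr

/-- A configuration: program counter, registers, memory. -/
structure Config where
  pc : ℕ
  reg : ℕ → ℕ
  mem : ℕ → ℕ

/-- The effect of one instruction. -/
def Instr.exec : Instr → Config → Config
  | .const d c, s => ⟨s.pc + 1, Function.update s.reg d c, s.mem⟩
  | .add d a b, s => ⟨s.pc + 1, Function.update s.reg d (s.reg a + s.reg b), s.mem⟩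
  | .sub d a b, s => ⟨s.pc + 1, Function.update s.reg d (s.reg a - s.reg b), s.mem⟩
  | .half d a, s => ⟨s.pc + 1, Function.update s.reg d (s.reg a / 2), s.mem⟩
  | .load d a, s => ⟨s.pc + 1, Function.update s.reg d (s.mem (s.reg a)), s.mem⟩
  | .store a b, s => ⟨s.pc + 1, s.reg, Function.update s.mem (s.reg a) (s.reg b)⟩
  | .jz a l, s => ⟨if s.reg a = 0 then l else s.pc + 1, s.reg, s.mem⟩

/-- One step of the program `P`. The machine has halted, and its configuration does not change any
more, once the program counter points outside of `P`. -/
def step (P : Program) (s : Config) : Config :=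
  match P[s.pc]? with
  | some i => i.exec s
  | none => s

/-- The initial configuration: the input words are in the memory cells `0, 1, 2, …`, their number is
in register `0`, and everything else is `0`. -/
def init (x : List ℕ) : Config where
  pc := 0
  reg := Function.update (fun _ => 0) 0 x.length
  mem := fun i => x.getD i 0

/-- On input `x`, the program `P` halts after at most `T` steps with `y` in register `0`. -/
def OutputsWithin (P : Program) (x : List ℕ) (y T : ℕ) : Prop :=
  ∃ k ≤ T, P.length ≤ ((step P)^[k] (init x)).pc ∧ ((step P)^[k] (init x)).reg 0 = y

/-- The length of an input in bits (with one separator for each word). -/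
def bitLength (x : List ℕ) : ℕ := (x.map fun w => Nat.size w + 1).sum

/-- The problem of computing `F` on instances from `α`, presented to the machine through the
encoding `enc`, is fixed-parameter tractable for the parameter `κ`: one program solves every
instance `I` in time `f (κ I) * |I| ^ c`, where `f` is computable and `c` is a constant. -/
def FixedParameterTractable {α : Type} (enc : α → List ℕ) (κ : α → ℕ) (F : α → ℕ) : Prop :=
  ∃ (P : Program) (f : ℕ → ℕ) (c : ℕ), Computable f ∧
    ∀ I : α, OutputsWithin P (enc I) (F I) (f (κ I) * bitLength (enc I) ^ c)

end RAM

/-! ## Maximum colored disjoint paths -/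

namespace MaxCDP

/-- An instance: an undirected graph on `n` vertices, an assignment of a set of colors (out of `q`
colors) to each edge, and two distinct vertices `s` and `t`. -/
structure Instance where
  n : ℕ
  q : ℕ
  G : SimpleGraph (Fin n)
  color : G.edgeSet → Finset (Fin q)
  s : Fin n
  t : Fin n
  s_ne_t : s ≠ t

namespace Instance

variable (I : Instance)

/-- Some color is assigned to all the edges of the path `p`. -/
def UniColor (p : I.G.Path I.s I.t) : Prop :=
  ∃ c : Fin I.q, ∀ (e : Sym2 (Fin I.n)) (he : e ∈ p.1.edges),
    c ∈ I.color ⟨e, p.1.edges_subset_edgeSet he⟩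

/-- Two `st`-paths share no internal vertex: they meet in `s` and `t` only. -/
def InternallyDisjoint (p p' : I.G.Path I.s I.t) : Prop :=
  ∀ x, x ∈ p.1.support → x ∈ p'.1.support → x = I.s ∨ x = I.t

/-- A feasible solution: a set of uni-color `st`-paths that are pairwise internally disjoint. -/
def IsSolution (S : Finset (I.G.Path I.s I.t)) : Prop :=
  (∀ p ∈ S, I.UniColor p) ∧ ∀ p ∈ S, ∀ p' ∈ S, p ≠ p' → I.InternallyDisjoint p p'

/-- The maximum number of disjoint uni-color `st`-paths. -/
noncomputable def opt : ℕ :=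
  sSup {m | ∃ S : Finset (I.G.Path I.s I.t), I.IsSolution S ∧ S.card = m}

/-- The supremum that defines `opt` is attained. -/
theorem isGreatest_opt :
    IsGreatest {m | ∃ S : Finset (I.G.Path I.s I.t), I.IsSolution S ∧ S.card = m} I.opt := by
  classical
  refine ⟨Nat.sSup_mem ⟨0, ∅, ⟨by simp, by simp⟩, rfl⟩ ?_, fun m hm => le_csSup ?_ hm⟩ <;>
  · refine ⟨Fintype.card (I.G.Path I.s I.t), ?_⟩
    rintro m ⟨S, -, rfl⟩
    exact S.card_le_univ

/-- The size of a minimum vertex cover of the graph (which is finite). -/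
noncomputable def vertexCoverNumber : ℕ := I.G.vertexCoverNum.toNat

open Classical in
/-- The entry of the adjacency matrix. -/
noncomputable def adjBit (u v : Fin I.n) : ℕ := if I.G.Adj u v then 1 else 0

open Classical in
/-- `1` if `uv` is an edge to which the color `c` is assigned, and `0` otherwise. -/
noncomputable def colorBit (c : Fin I.q) (u v : Fin I.n) : ℕ :=
  if h : I.G.Adj u v then (if c ∈ I.color ⟨s(u, v), h⟩ then 1 else 0) else 0

/-- The encoding of an instance: `n`, `q`, `s`, `t`, the adjacency matrix row by row, and then for
each color the adjacency matrix of the edges of that color. -/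
noncomputable def encode : List ℕ :=
  [I.n, I.q, I.s, I.t] ++
  ((List.finRange I.n).flatMap fun u => (List.finRange I.n).map fun v => I.adjBit u v) ++
  ((List.finRange I.q).flatMap fun c => (List.finRange I.n).flatMap fun u =>
    (List.finRange I.n).map fun v => I.colorBit c u v)

end Instance

/-- The encoding of an instance together with a threshold `r` for the number of paths. -/
noncomputable def encodeThreshold (x : Instance × ℕ) : List ℕ := x.1.encode ++ [x.2]

open Classical in
/-- The answer (`1` for yes, `0` for no) to the question whether there exist at least `r` disjoint
uni-color `st`-paths. -/
noncomputable def decideThreshold (x : Instance × ℕ) : ℕ :=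
  if ∃ S : Finset (x.1.G.Path x.1.s x.1.t), x.1.IsSolution S ∧ x.2 ≤ S.card then 1 else 0

end MaxCDP

/-! Let `A` be a vertex cover of size `k`. In a solution, at most one path is the edge `st`, and the
paths through good vertices (those `v` for which `s`, `v`, `t` is a uni-color path) are at most as
many as the good vertices, so nothing is lost by using each good vertex in its path of length two.
Every other path has length at least three, since the middle vertex of a uni-color path of length
two is good. Its second edge joins two inner vertices, one of them in `A`. Hence there are at most
`k` such paths, and each has at most `2k + 1` vertices because `A` meets every edge. The difficult
part of an optimal solution thus lives on a set `U` of at most `M = k(2k + 1)` vertices.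

This invites derandomized color coding. For any partition of the vertices, one path per class is
sought among the vertices that are not good, by reachability in each color; with the direct edge and
the good vertices this always gives a solution (`value_le_opt`), and an optimal one if the partition
keeps the difficult paths apart (`exists_partition`). Few partitions suffice: `M` positions of
binary digits separate the elements of `U` (`exists_separating_positions`), so these positions and a
table of `2 ^ M` classes describe a suitable partition (`exists_classOf`). These are `L = M + 2 ^ M`
digits in a base `k + O(log n)`, and a logarithm to the power `L` is at most a function of `L` times
a linear term (`pow_le_pow_self_mul_two_pow`). A maximal matching provides a cover with `k` at most
twice the minimum (`exists_cover`).

For the machine model, the algorithm is an expression with bounded loops, which is compiled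
(`runs_compile`). If no loop exceeds `T` rounds, the time is polynomial in `T` (`exists_steps_le`),
so it remains to bound all loops by a function of the parameter times the input length
(`bounds_of_encodes`). -/

/-! ## A functional language and its compilation to the random access machine -/

namespace RAM

/-- Expressions with a read-only memory. Variables are de Bruijn indices into an environment. -/
inductive Expr where
  | var (i : ℕ)
  | const (c : ℕ)
  | add (a b : Expr)
  | sub (a b : Expr)
  | half (a : Expr)
  | load (a : Expr)
  /-- `ite c a b` is `a` if `c ≠ 0` and `b` otherwise -/
  | ite (c a b : Expr)
  /-- evaluate `f` with the value of `a` pushed onto the environment -/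
  | bind (a f : Expr)
  /-- evaluate `a` without the first `k` entries of the environment -/
  | lift (k : ℕ) (a : Expr)
  /-- `fold n z f` iterates `f`, which sees the accumulator and the index, `n` times from `z` -/
  | fold (n z f : Expr)

namespace Expr

/-- The value of an expression. -/
def eval (m : ℕ → ℕ) : Expr → List ℕ → ℕ
  | var i, E => E.getD i 0
  | const c, _ => c
  | add a b, E => a.eval m E + b.eval m E
  | sub a b, E => a.eval m E - b.eval m E
  | half a, E => a.eval m E / 2
  | load a, E => m (a.eval m E)
  | ite c a b, E => if c.eval m E = 0 then b.eval m E else a.eval m E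
  | bind a f, E => f.eval m (a.eval m E :: E)
  | lift k a, E => a.eval m (E.drop k)
  | fold n z f, E => Nat.rec (z.eval m E) (fun i x => f.eval m (x :: i :: E)) (n.eval m E)

/-- All loops met during the evaluation of an expression run at most `T` times. -/
def Ok (T : ℕ) (m : ℕ → ℕ) : Expr → List ℕ → Prop
  | var _, _ => True
  | const _, _ => True
  | add a b, E => a.Ok T m E ∧ b.Ok T m E
  | sub a b, E => a.Ok T m E ∧ b.Ok T m E
  | half a, E => a.Ok T m E
  | load a, E => a.Ok T m E
  | ite c a b, E => c.Ok T m E ∧ a.Ok T m E ∧ b.Ok T m E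
  | bind a f, E => a.Ok T m E ∧ f.Ok T m (a.eval m E :: E)
  | lift k a, E => a.Ok T m (E.drop k)
  | fold n z f, E => n.Ok T m E ∧ z.Ok T m E ∧ n.eval m E ≤ T ∧
      ∀ i < n.eval m E, f.Ok T m
        (Nat.rec (z.eval m E) (fun i x => f.eval m (x :: i :: E)) i :: i :: E)

/-- The code of an expression, to be placed at address `p`. The environment is in the registers
`ρ`, all below `d`. The value is left in register `d`, and registers below `d` are not changed. -/
def compile : Expr → List ℕ → ℕ → ℕ → Program
  | var i, ρ, d, _ => .const d 0 :: if h : i < ρ.length then [.add d ρ[i] d] else []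
  | const c, _, d, _ => [.const d c]
  | add a b, ρ, d, p =>
      let A := a.compile ρ d p
      A ++ (b.compile ρ (d + 1) (p + A.length) ++ [.add d d (d + 1)])
  | sub a b, ρ, d, p =>
      let A := a.compile ρ d p
      A ++ (b.compile ρ (d + 1) (p + A.length) ++ [.sub d d (d + 1)])
  | half a, ρ, d, p => a.compile ρ d p ++ [.half d d]
  | load a, ρ, d, p => a.compile ρ d p ++ [.load d d]
  | ite c a b, ρ, d, p =>
      let C := c.compile ρ d p
      let A := a.compile ρ d (p + C.length + 1)
      let B := b.compile ρ d (p + C.length + 1 + A.length + 2)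
      C ++ (.jz d (p + C.length + 1 + A.length + 2) ::
        (A ++ (.const (d + 1) 0 ::
          .jz (d + 1) (p + C.length + 1 + A.length + 2 + B.length) :: B)))
  | bind a f, ρ, d, p =>
      let A := a.compile ρ d p
      A ++ (f.compile (d :: ρ) (d + 1) (p + A.length) ++ [.const d 0, .add d d (d + 1)])
  | lift k a, ρ, d, p => a.compile (ρ.drop k) d p
  | fold n z f, ρ, d, p =>
      let A := n.compile ρ d p
      let Z := z.compile ρ (d + 1) (p + A.length)
      let q := p + A.length + Z.length + 1
      let F := f.compile ((d + 1) :: (d + 2) :: ρ) (d + 3) (q + 2)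
      A ++ (Z ++ (.const (d + 2) 0 :: .sub (d + 3) d (d + 2) :: .jz (d + 3) (q + 2 + F.length + 6) ::
        (F ++ [.const (d + 4) 0, .add (d + 1) (d + 3) (d + 4), .const (d + 4) 1,
          .add (d + 2) (d + 2) (d + 4), .const (d + 4) 0, .jz (d + 4) q,
          .const (d + 3) 0, .add d (d + 1) (d + 3)])))

/-- A bound for the number of steps when all loops run at most `T` times. -/
def steps (T : ℕ) : Expr → ℕ
  | var _ => 2
  | const _ => 1
  | add a b => a.steps T + (b.steps T + 1)
  | sub a b => a.steps T + (b.steps T + 1)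
  | half a => a.steps T + 1
  | load a => a.steps T + 1
  | ite c a b => c.steps T + (1 + (a.steps T + b.steps T + 2))
  | bind a f => a.steps T + (f.steps T + 2)
  | lift _ a => a.steps T
  | fold n z f => n.steps T + (z.steps T + (1 + (T * (f.steps T + 8) + 4)))

end Expr

/-- The code `l` is part of the program `P`, from address `p` on. -/
def CodeAt (P : Program) (p : ℕ) (l : Program) : Prop :=
  ∀ i < l.length, P[p + i]? = l[i]?

theorem codeAt_cons {P : Program} {p : ℕ} {i : Instr} {c : Program} :
    CodeAt P p (i :: c) ↔ P[p]? = some i ∧ CodeAt P (p + 1) c := by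
  constructor
  · intro h
    refine ⟨by simpa using h 0 (by simp), fun j hj => ?_⟩
    have := h (j + 1) (by simpa using hj)
    rw [show p + 1 + j = p + (j + 1) by ring, this]
    simp
  · rintro ⟨h, h'⟩ (_ | j) hj
    · simpa using h
    · rw [show p + (j + 1) = p + 1 + j by ring, h' j (by simpa using hj)]
      simp

theorem codeAt_nil {P : Program} {p : ℕ} : CodeAt P p [] := by
  simp [CodeAt]

theorem codeAt_append {P : Program} {p : ℕ} {c c' : Program} :
    CodeAt P p (c ++ c') ↔ CodeAt P p c ∧ CodeAt P (p + c.length) c' := by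
  induction c generalizing p with
  | nil => simp [codeAt_nil]
  | cons i c ih =>
    simp only [List.cons_append, codeAt_cons, ih, List.length_cons, and_assoc]
    rw [show p + 1 + c.length = p + (c.length + 1) by ring]

/-- Within `T` steps, the machine gets from address `p` and registers `r` to `p'` and `r'`, with
memory `m` before and after. -/
def Runs (P : Program) (m : ℕ → ℕ) (T p : ℕ) (r : ℕ → ℕ) (p' : ℕ) (r' : ℕ → ℕ) : Prop :=
  ∃ k ≤ T, (step P)^[k] ⟨p, r, m⟩ = ⟨p', r', m⟩

section Runs

variable {P : Program} {m : ℕ → ℕ} {p p' p'' T T' : ℕ} {r r' r'' : ℕ → ℕ}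

theorem Runs.refl : Runs P m 0 p r p r := ⟨0, le_rfl, rfl⟩

theorem Runs.trans (h : Runs P m T p r p' r') (h' : Runs P m T' p' r' p'' r'') :
    Runs P m (T + T') p r p'' r'' := by
  obtain ⟨k, hk, e⟩ := h
  obtain ⟨k', hk', e'⟩ := h'
  exact ⟨k' + k, by omega, by rw [Function.iterate_add_apply, e, e']⟩

theorem Runs.mono (h : Runs P m T p r p' r') (hT : T ≤ T') : Runs P m T' p r p' r' := by
  obtain ⟨k, hk, e⟩ := h
  exact ⟨k, hk.trans hT, e⟩

theorem Runs.cast (h : Runs P m T p r p' r') (hT : T ≤ T') (hp : p' = p'') :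
    Runs P m T' p r p'' r' :=
  hp ▸ h.mono hT

theorem Runs.of_exec {i : Instr} (h : P[p]? = some i) (e : i.exec ⟨p, r, m⟩ = ⟨p', r', m⟩) :
    Runs P m 1 p r p' r' :=
  ⟨1, le_rfl, by simp [step, h, e]⟩

theorem Runs.const {d c : ℕ} (h : P[p]? = some (.const d c)) :
    Runs P m 1 p r (p + 1) (Function.update r d c) := .of_exec h rfl

theorem Runs.add {d a b : ℕ} (h : P[p]? = some (.add d a b)) :
    Runs P m 1 p r (p + 1) (Function.update r d (r a + r b)) := .of_exec h rfl

theorem Runs.sub {d a b : ℕ} (h : P[p]? = some (.sub d a b)) :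
    Runs P m 1 p r (p + 1) (Function.update r d (r a - r b)) := .of_exec h rfl

theorem Runs.half {d a : ℕ} (h : P[p]? = some (.half d a)) :
    Runs P m 1 p r (p + 1) (Function.update r d (r a / 2)) := .of_exec h rfl

theorem Runs.load {d a : ℕ} (h : P[p]? = some (.load d a)) :
    Runs P m 1 p r (p + 1) (Function.update r d (m (r a))) := .of_exec h rfl

theorem Runs.jz_zero {a l : ℕ} (h : P[p]? = some (.jz a l)) (ha : r a = 0) :
    Runs P m 1 p r l r := .of_exec h (by simp [Instr.exec, ha])

theorem Runs.jz_ne_zero {a l : ℕ} (h : P[p]? = some (.jz a l)) (ha : r a ≠ 0) :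
    Runs P m 1 p r (p + 1) r := .of_exec h (by simp [Instr.exec, ha])

end Runs

namespace Expr

theorem map_congr_of_lt {ρ : List ℕ} {d : ℕ} {r r' : ℕ → ℕ} (hρ : ∀ x ∈ ρ, x < d)
    (h : ∀ x < d, r' x = r x) : ρ.map r' = ρ.map r :=
  List.map_congr_left fun x hx => h x (hρ x hx)

/-- The compiler is correct. -/
theorem runs_compile (T : ℕ) (m : ℕ → ℕ) (e : Expr) : ∀ (ρ : List ℕ) (d p : ℕ) (P : Program)
    (r : ℕ → ℕ), (∀ x ∈ ρ, x < d) → CodeAt P p (e.compile ρ d p) → e.Ok T m (ρ.map r) →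
    ∃ r', Runs P m (e.steps T) p r (p + (e.compile ρ d p).length) r' ∧
      r' d = e.eval m (ρ.map r) ∧ ∀ x < d, r' x = r x := by
  induction e with
  | var i =>
    intro ρ d p P r hρ hc _
    simp only [compile, codeAt_cons] at hc
    obtain ⟨h1, h2⟩ := hc
    by_cases h : i < ρ.length
    · simp only [h, dite_true, codeAt_cons] at h2
      refine ⟨_, by simpa [compile, h, add_assoc, steps] using (Runs.const h1).trans (Runs.add h2.1), ?_, ?_⟩
      · have := (hρ ρ[i] (List.getElem_mem h)).ne
        simp [eval, h, this]
      · intro x hx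
        simp [hx.ne]
    · refine ⟨_, by simpa [compile, h] using (Runs.const h1).mono (by simp [steps]), ?_, ?_⟩
      · simp [eval, h]
      · intro x hx
        simp [hx.ne]
  | const c =>
    intro ρ d p P r hρ hc _
    simp only [compile, codeAt_cons] at hc
    refine ⟨_, by simpa [compile] using (Runs.const hc.1).mono (by simp [steps]), ?_, ?_⟩
    · simp [eval]
    · intro x hx
      simp [hx.ne]
  | add a b iha ihb =>
    intro ρ d p P r hρ hc ho
    simp only [compile, codeAt_append, codeAt_cons] at hc
    obtain ⟨ha, hb, h, -⟩ := hc
    obtain ⟨r1, R1, v1, f1⟩ := iha ρ d p P r hρ ha ho.1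
    have e1 := map_congr_of_lt hρ f1
    obtain ⟨r2, R2, v2, f2⟩ := ihb ρ (d + 1) _ P r1 (fun x hx => (hρ x hx).trans (by omega)) hb
      (e1 ▸ ho.2)
    refine ⟨_, by simpa [compile, steps, add_assoc] using R1.trans (R2.trans (Runs.add h)), ?_, ?_⟩
    · simp [eval, v2, e1, f2 d (by omega), v1]
    · intro x hx
      simp [hx.ne, f2 x (by omega), f1 x hx]
  | sub a b iha ihb =>
    intro ρ d p P r hρ hc ho
    simp only [compile, codeAt_append, codeAt_cons] at hc
    obtain ⟨ha, hb, h, -⟩ := hc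
    obtain ⟨r1, R1, v1, f1⟩ := iha ρ d p P r hρ ha ho.1
    have e1 := map_congr_of_lt hρ f1
    obtain ⟨r2, R2, v2, f2⟩ := ihb ρ (d + 1) _ P r1 (fun x hx => (hρ x hx).trans (by omega)) hb
      (e1 ▸ ho.2)
    refine ⟨_, by simpa [compile, steps, add_assoc] using R1.trans (R2.trans (Runs.sub h)), ?_, ?_⟩
    · simp [eval, v2, e1, f2 d (by omega), v1]
    · intro x hx
      simp [hx.ne, f2 x (by omega), f1 x hx]
  | half a ih =>
    intro ρ d p P r hρ hc ho
    simp only [compile, codeAt_append, codeAt_cons] at hc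
    obtain ⟨ha, h, -⟩ := hc
    obtain ⟨r1, R1, v1, f1⟩ := ih ρ d p P r hρ ha ho
    refine ⟨_, by simpa [compile, steps, add_assoc] using R1.trans (Runs.half h), ?_, ?_⟩
    · simp [eval, v1]
    · intro x hx
      simp [hx.ne, f1 x hx]
  | load a ih =>
    intro ρ d p P r hρ hc ho
    simp only [compile, codeAt_append, codeAt_cons] at hc
    obtain ⟨ha, h, -⟩ := hc
    obtain ⟨r1, R1, v1, f1⟩ := ih ρ d p P r hρ ha ho
    refine ⟨_, by simpa [compile, steps, add_assoc] using R1.trans (Runs.load h), ?_, ?_⟩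
    · simp [eval, v1]
    · intro x hx
      simp [hx.ne, f1 x hx]
  | ite c a b ihc iha ihb =>
    intro ρ d p P r hρ hc ho
    simp only [compile, codeAt_append, codeAt_cons] at hc
    obtain ⟨hcc, hj, ha, h1, h2, hb⟩ := hc
    obtain ⟨r1, R1, v1, f1⟩ := ihc ρ d p P r hρ hcc ho.1
    have e1 := map_congr_of_lt hρ f1
    by_cases h0 : c.eval m (ρ.map r) = 0
    · obtain ⟨r2, R2, v2, f2⟩ := ihb ρ d (p + (c.compile ρ d p).length + 1 +
        (a.compile ρ d (p + (c.compile ρ d p).length + 1)).length + 2) P r1 hρ hb (e1 ▸ ho.2.2)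
      exact ⟨r2, (R1.trans ((Runs.jz_zero hj (v1.trans h0)).trans R2)).cast
        (by simp only [steps]; omega)
        (by simp only [compile, List.length_append, List.length_cons]; omega),
        by simp [eval, h0, v2, e1], fun x hx => by rw [f2 x hx, f1 x hx]⟩
    · obtain ⟨r2, R2, v2, f2⟩ := iha ρ d _ P r1 hρ ha (e1 ▸ ho.2.1)
      refine ⟨_, (R1.trans ((Runs.jz_ne_zero hj (by rwa [v1])).trans (R2.trans
        -- A jump on a register that has just been cleared is unconditional; it skips the code of
        -- the other branch.
        ((Runs.const h1).trans (Runs.jz_zero h2 (by simp)))))).cast (by simp only [steps]; omega)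
        (by simp only [compile, List.length_append, List.length_cons]; omega), ?_, ?_⟩
      · simp [eval, h0, v2, e1]
      · intro x hx
        rw [Function.update_of_ne (by omega), f2 x hx, f1 x hx]
  | bind a f iha ihf =>
    intro ρ d p P r hρ hc ho
    simp only [compile, codeAt_append, codeAt_cons] at hc
    obtain ⟨ha, hf, h1, h2, -⟩ := hc
    obtain ⟨r1, R1, v1, f1⟩ := iha ρ d p P r hρ ha ho.1
    have e1 : (d :: ρ).map r1 = a.eval m (ρ.map r) :: ρ.map r := by
      simp [v1, map_congr_of_lt hρ f1]
    obtain ⟨r2, R2, v2, f2⟩ := ihf (d :: ρ) (d + 1) _ P r1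
      (by simp only [List.mem_cons, forall_eq_or_imp]; exact ⟨by omega, fun x hx =>
        (hρ x hx).trans (by omega)⟩) hf (e1 ▸ ho.2)
    refine ⟨_, by
      simpa [compile, steps, add_assoc] using
        R1.trans (R2.trans ((Runs.const h1).trans (Runs.add h2))), ?_, ?_⟩
    · simp [eval, v2, v1, map_congr_of_lt hρ f1]
    · intro x hx
      simp [hx.ne, f2 x (by omega), f1 x hx]
  | lift k a ih =>
    intro ρ d p P r hρ hc ho
    obtain ⟨r1, R1, v1, f1⟩ := ih (ρ.drop k) d p P r (fun x hx => hρ x (List.mem_of_mem_drop hx)) hc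
      (by simpa [Ok, List.map_drop] using ho)
    exact ⟨r1, R1, by simp [eval, v1, List.map_drop], f1⟩
  | fold n z f ihn ihz ihf =>
    intro ρ d p P r hρ hc ho
    simp only [compile, codeAt_append, codeAt_cons] at hc
    set A := n.compile ρ d p with hA
    set Z := z.compile ρ (d + 1) (p + A.length) with hZ
    set q := p + A.length + Z.length + 1 with hq
    set F := f.compile ((d + 1) :: (d + 2) :: ρ) (d + 3) (q + 2) with hF
    obtain ⟨hn, hz, h1, h2, h3, hf, h4, h5, h6, h7, h8, h9, h10, h11, -⟩ := hc
    obtain ⟨on, oz, oT, of⟩ := ho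
    set E := ρ.map r with hE
    set N := n.eval m E with hN
    set X : ℕ → ℕ := fun i => Nat.rec (z.eval m E) (fun i x => f.eval m (x :: i :: E)) i with hX
    obtain ⟨r1, R1, v1, f1⟩ := ihn ρ d p P r hρ hn on
    have e1 := map_congr_of_lt hρ f1
    obtain ⟨r2, R2, v2, f2⟩ := ihz ρ (d + 1) _ P r1 (fun x hx => (hρ x hx).trans (by omega)) hz
      (e1 ▸ oz)
    -- Invariant at the loop head `q`: register `d` holds the number of rounds, `d + 1` the
    -- accumulator and `d + 2` the index. Register `d + 3` serves for the exit test and then for the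
    -- value of the body. A round costs eight instructions besides the body.
    have loop : ∀ i ≤ N, ∃ r', Runs P m (i * (f.steps T + 8)) q (Function.update r2 (d + 2) 0) q r' ∧
        r' d = N ∧ r' (d + 1) = X i ∧ r' (d + 2) = i ∧ ∀ x < d, r' x = r x := by
      intro i
      induction i with
      | zero =>
        intro _
        refine ⟨_, by simpa using Runs.refl, ?_, ?_, ?_, fun x hx => ?_⟩
        · simp [f2 d (by omega), v1, hN, hE]
        · simp [v2, e1, hX, hE]
        · simp
        · rw [Function.update_of_ne (by omega), f2 x (by omega), f1 x hx]
      | succ i ih =>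
        intro hi
        obtain ⟨r3, R3, u1, u2, u3, u4⟩ := ih (by omega)
        have e3 : ((d + 1) :: (d + 2) :: ρ).map (Function.update r3 (d + 3) (r3 d - r3 (d + 2))) =
            X i :: i :: E := by
          have : ρ.map (Function.update r3 (d + 3) (r3 d - r3 (d + 2))) = E :=
            map_congr_of_lt hρ fun x hx => by rw [Function.update_of_ne (by omega), u4 x hx]
          rw [List.map_cons, List.map_cons, this]
          simp [u2, u3]
        obtain ⟨r4, R4, v4, f4⟩ := ihf ((d + 1) :: (d + 2) :: ρ) (d + 3) (q + 1 + 1) P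
          (Function.update r3 (d + 3) (r3 d - r3 (d + 2)))
          (by simp only [List.mem_cons, forall_eq_or_imp]; exact ⟨by omega, by omega, fun x hx =>
            (hρ x hx).trans (by omega)⟩) hf (e3 ▸ of i (by omega))
        rw [e3] at v4
        have g1 : r4 (d + 2) = i := by
          rw [f4 _ (by omega), Function.update_of_ne (by omega), u3]
        refine ⟨_, ((R3.trans (((Runs.sub h2).trans (Runs.jz_ne_zero h3 ?_)).trans (R4.trans
          ((Runs.const h4).trans ((Runs.add h5).trans ((Runs.const h6).trans ((Runs.add h7).trans
          ((Runs.const h8).trans (Runs.jz_zero h9 ?_)))))))))).mono ?_, ?_, ?_, ?_, ?_⟩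
        · simp [u1, u3]; omega
        · simp
        · rw [add_mul, one_mul]
          omega
        · simp [f4 d (by omega), u1]
        · simp [v4, hX]
        · simp [g1]
        · intro x hx
          rw [Function.update_of_ne (by omega), Function.update_of_ne (by omega),
            Function.update_of_ne (by omega), Function.update_of_ne (by omega),
            Function.update_of_ne (by omega), f4 x (by omega), Function.update_of_ne (by omega),
            u4 x hx]
    obtain ⟨r3, R3, u1, u2, u3, u4⟩ := loop N le_rfl
    have h10' : P[q + 2 + F.length + 6]? = some (.const (d + 3) 0) := h10
    have h11' : P[q + 2 + F.length + 6 + 1]? = some (.add d (d + 1) (d + 3)) := h11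
    have R := R1.trans (R2.trans ((Runs.const h1).trans (R3.trans ((Runs.sub h2).trans
      ((Runs.jz_zero h3 (by simp [u1, u3])).trans ((Runs.const h10').trans (Runs.add h11')))))))
    refine ⟨_, R.cast ?_ ?_, ?_, ?_⟩
    · have : N * (f.steps T + 8) ≤ T * (f.steps T + 8) := Nat.mul_le_mul_right _ oT
      simp only [steps]
      omega
    · simp only [compile, List.length_append, List.length_cons, List.length_nil, ← hA, ← hZ, ← hq,
        ← hF]
      omega
    · simp [eval, u2, hX, ← hN]
    · intro x hx
      rw [Function.update_of_ne (by omega), Function.update_of_ne (by omega),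
        Function.update_of_ne (by omega), u4 x hx]

/-- The expression is fixed, so its loops are nested to a fixed depth, and each `fold` contributes
one factor `T`. In sums the degrees are crudely added, which is where `1 ≤ T` enters. -/
theorem exists_steps_le (e : Expr) : ∃ a k, ∀ T, 1 ≤ T → e.steps T ≤ a * T ^ k := by
  have key : ∀ {f g : ℕ → ℕ}, (∃ a k, ∀ T, 1 ≤ T → f T ≤ a * T ^ k) →
      (∃ a k, ∀ T, 1 ≤ T → g T ≤ a * T ^ k) → ∃ a k, ∀ T, 1 ≤ T → f T + g T ≤ a * T ^ k := by
    rintro f g ⟨a, k, h⟩ ⟨b, l, h'⟩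
    refine ⟨a + b, k + l, fun T hT => (add_le_add (h T hT) (h' T hT)).trans ?_⟩
    rw [add_mul]
    exact add_le_add (Nat.mul_le_mul_left _ (Nat.pow_le_pow_right hT (by omega)))
      (Nat.mul_le_mul_left _ (Nat.pow_le_pow_right hT (by omega)))
  have cst : ∀ c : ℕ, ∃ a k, ∀ T, 1 ≤ T → c ≤ a * T ^ k := fun c => ⟨c, 0, by simp⟩
  induction e with
  | var i => exact cst 2
  | const c => exact cst 1
  | add a b iha ihb => exact key iha (key ihb (cst 1))
  | sub a b iha ihb => exact key iha (key ihb (cst 1))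
  | half a ih => exact key ih (cst 1)
  | load a ih => exact key ih (cst 1)
  | ite c a b ihc iha ihb => exact key ihc (key (cst 1) (key (key iha ihb) (cst 2)))
  | bind a f iha ihf => exact key iha (key ihf (cst 2))
  | lift k a ih => exact ih
  | fold n z f ihn ihz ihf =>
    refine key ihn (key ihz (key (cst 1) (key ?_ (cst 4))))
    obtain ⟨a, k, h⟩ := key ihf (cst 8)
    refine ⟨a, k + 1, fun T hT => (Nat.mul_le_mul_left T (h T hT)).trans (le_of_eq ?_)⟩
    ring

/-- Running the code of an expression as a program. -/
theorem outputsWithin_compile (e : Expr) (x : List ℕ) (T : ℕ)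
    (h : e.Ok T (fun i => x.getD i 0) []) :
    OutputsWithin (e.compile [] 0 0) x (e.eval (fun i => x.getD i 0) []) (e.steps T) := by
  obtain ⟨r', ⟨k, hk, e1⟩, v, -⟩ := runs_compile T (fun i => x.getD i 0) e [] 0 0
    (e.compile [] 0 0) (Function.update (fun _ => 0) 0 x.length) (by simp)
    (fun i _ => by simp) h
  refine ⟨k, hk, ?_⟩
  rw [show init x = ⟨0, Function.update (fun _ => 0) 0 x.length, fun i => x.getD i 0⟩ from rfl, e1]
  exact ⟨by simp, v⟩

end Expr

end RAM

/-! ## A small library of expressions -/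

namespace RAM.Expr

/-- The value is nonzero, which means "true". -/
def Holds (m : ℕ → ℕ) (e : Expr) (E : List ℕ) : Prop := e.eval m E ≠ 0

instance (m : ℕ → ℕ) (e : Expr) (E : List ℕ) : Decidable (e.Holds m E) :=
  inferInstanceAs (Decidable (_ ≠ _))

/-- Negation. -/
def not (a : Expr) : Expr := sub (const 1) a
/-- Conjunction. -/
def and (a b : Expr) : Expr := ite a b (const 0)
/-- Disjunction. -/
def or (a b : Expr) : Expr := ite a (const 1) b
/-- Comparison. -/
def le (a b : Expr) : Expr := not (sub a b)
/-- Equality. -/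
def eq (a b : Expr) : Expr := and (le a b) (le b a)
/-- Multiplication. -/
def mul (a b : Expr) : Expr := fold b (const 0) (add (var 0) (lift 2 a))
/-- Exponentiation. -/
def pow (a b : Expr) : Expr := fold b (const 1) (mul (var 0) (lift 2 a))
/-- Division. -/
def div (a b : Expr) : Expr :=
  fold a (const 0)
    (ite (le (mul (add (var 0) (const 1)) (lift 2 b)) (lift 2 a)) (add (var 0) (const 1)) (var 0))
/-- Remainder. -/
def mod (a b : Expr) : Expr := sub a (mul (div a b) b)
/-- The binary digit of `a` at position `i`. -/
def bit (a i : Expr) : Expr :=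
  bind (fold i a (half (var 0))) (sub (var 0) (add (half (var 0)) (half (var 0))))
/-- The sum of the values of `f` over the indices below `n`. -/
def sum (n f : Expr) : Expr := fold n (const 0) (add (var 0) (lift 1 f))
/-- Bounded existential quantifier. -/
def ex (n f : Expr) : Expr := fold n (const 0) (ite (lift 1 f) (const 1) (var 0))
/-- The maximum of the values of `f` over the indices below `n`. -/
def max (n f : Expr) : Expr := fold n (const 0) (add (var 0) (sub (lift 1 f) (var 0)))
/-- The number of indices below `n` for which `f` holds. -/
def count (n f : Expr) : Expr := sum n (ite f (const 1) (const 0))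
/-- The number whose binary digits at positions below `n` are given by `f`. -/
def mask (n f : Expr) : Expr := sum n (ite f (pow (const 2) (var 0)) (const 0))

/-! ### Values of the library expressions -/

variable {m : ℕ → ℕ} {a b n f : Expr} {E : List ℕ} {T : ℕ}

@[simp] theorem eval_var (i : ℕ) : (var i).eval m E = E.getD i 0 := rfl
@[simp] theorem eval_const (c : ℕ) : (const c).eval m E = c := rfl
@[simp] theorem eval_add : (add a b).eval m E = a.eval m E + b.eval m E := rfl
@[simp] theorem eval_sub : (sub a b).eval m E = a.eval m E - b.eval m E := rfl
@[simp] theorem eval_half : (half a).eval m E = a.eval m E / 2 := rfl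
@[simp] theorem eval_load : (load a).eval m E = m (a.eval m E) := rfl
@[simp] theorem eval_lift (k : ℕ) : (lift k a).eval m E = a.eval m (E.drop k) := rfl
@[simp] theorem eval_bind : (bind a f).eval m E = f.eval m (a.eval m E :: E) := rfl

theorem eval_ite {c : Expr} :
    (ite c a b).eval m E = if c.Holds m E then a.eval m E else b.eval m E := by
  by_cases h : c.eval m E = 0 <;> simp [eval, Holds, h]

@[simp] theorem holds_not : (not a).Holds m E ↔ ¬ a.Holds m E := by
  simp [Holds, not]; omega

@[simp] theorem holds_and : (and a b).Holds m E ↔ a.Holds m E ∧ b.Holds m E := by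
  by_cases h : a.eval m E = 0 <;> simp [Holds, and, eval, h]

@[simp] theorem holds_or : (or a b).Holds m E ↔ a.Holds m E ∨ b.Holds m E := by
  by_cases h : a.eval m E = 0 <;> simp [Holds, or, eval, h]

@[simp] theorem holds_le : (le a b).Holds m E ↔ a.eval m E ≤ b.eval m E := by
  simp [le]; simp [Holds]; omega

@[simp] theorem holds_eq : (eq a b).Holds m E ↔ a.eval m E = b.eval m E := by
  simp [eq]; omega

@[simp] theorem eval_mul : (mul a b).eval m E = a.eval m E * b.eval m E := by
  simp only [mul, eval]
  induction b.eval m E with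
  | zero => simp
  | succ k ih => rw [Nat.mul_succ, ← ih]; simp

@[simp] theorem eval_pow : (pow a b).eval m E = a.eval m E ^ b.eval m E := by
  simp only [pow, eval, eval_mul]
  induction b.eval m E with
  | zero => simp
  | succ k ih => rw [pow_succ, ← ih]; simp

theorem eval_div (h : 0 < b.eval m E) : (div a b).eval m E = a.eval m E / b.eval m E := by
  simp only [div, eval]
  -- The quotient is found by counting up until the next multiple of the divisor would be too large.
  -- For divisor `0` the counter would never stop growing, hence the hypothesis.
  have key : ∀ k, (Nat.rec 0 (fun i x => eval m ((((var 0).add (const 1)).mul (lift 2 b)).le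
      (lift 2 a)|>.ite ((var 0).add (const 1)) (var 0)) (x :: i :: E)) k : ℕ) =
      min k (a.eval m E / b.eval m E) := by
    intro k
    induction k with
    | zero => simp
    | succ k ih =>
      dsimp only
      rw [ih]
      simp only [eval_ite, holds_le, eval_mul, eval_add, eval_var, eval_const, eval_lift,
        List.getD_cons_zero, List.drop_succ_cons, List.drop_zero, ← Nat.le_div_iff_mul_le h]
      split_ifs <;> omega
  refine (key _).trans ?_
  exact min_eq_right (Nat.div_le_self _ _)

theorem eval_mod (h : 0 < b.eval m E) : (mod a b).eval m E = a.eval m E % b.eval m E := by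
  simp only [mod, eval_sub, eval_mul, eval_div h]
  have := Nat.div_add_mod' (a.eval m E) (b.eval m E)
  omega

@[simp] theorem eval_bit : (bit a b).eval m E = a.eval m E / 2 ^ b.eval m E % 2 := by
  simp only [bit, eval_bind, eval_sub, eval_add, eval_half, eval_var, List.getD_cons_zero]
  have : (fold b a (half (var 0))).eval m E = a.eval m E / 2 ^ b.eval m E := by
    simp only [eval]
    induction b.eval m E with
    | zero => simp
    | succ k ih =>
      dsimp only
      rw [ih, pow_succ, ← Nat.div_div_eq_div_mul, List.getD_cons_zero]
  rw [this]
  omega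

@[simp] theorem holds_bit :
    (bit a b).Holds m E ↔ (a.eval m E).testBit (b.eval m E) = true := by
  simp only [Holds, eval_bit, Nat.testBit_eq_decide_div_mod_eq, decide_eq_true_eq]
  omega

@[simp] theorem eval_sum :
    (sum n f).eval m E = ∑ i ∈ Finset.range (n.eval m E), f.eval m (i :: E) := by
  simp only [sum, eval]
  induction n.eval m E with
  | zero => simp
  | succ k ih => rw [Finset.sum_range_succ, ← ih]; simp

-- With truncated subtraction, `x + (y - x)` is the maximum of `x` and `y`.
@[simp] theorem eval_max :
    (max n f).eval m E = (Finset.range (n.eval m E)).sup fun i => f.eval m (i :: E) := by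
  simp only [max, eval]
  induction n.eval m E with
  | zero => simp
  | succ k ih => rw [Finset.range_add_one, Finset.sup_insert, ← ih]; simp; omega

@[simp] theorem holds_ex :
    (ex n f).Holds m E ↔ ∃ i < n.eval m E, f.Holds m (i :: E) := by
  simp only [ex, Holds, eval]
  induction n.eval m E with
  | zero => simp
  | succ k ih =>
    simp only [Nat.lt_succ_iff_lt_or_eq, or_and_right, exists_or, ← ih, exists_eq_left]
    by_cases h : f.eval m (k :: E) = 0 <;> simp [h]

@[simp] theorem eval_count : (count n f).eval m E =
    ((Finset.range (n.eval m E)).filter fun i => f.Holds m (i :: E)).card := by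
  simp [count, eval_ite]

theorem testBit_sum_two_pow (p : ℕ → Prop) [DecidablePred p] (n i : ℕ) :
    (∑ v ∈ Finset.range n, if p v then 2 ^ v else 0).testBit i = true ↔ i < n ∧ p i := by
  -- The bound `2 ^ n` is carried along in the induction: it ensures that the next power of two is
  -- added without a carry.
  suffices (∑ v ∈ Finset.range n, if p v then 2 ^ v else 0) < 2 ^ n ∧
      ((∑ v ∈ Finset.range n, if p v then 2 ^ v else 0).testBit i = true ↔ i < n ∧ p i) from this.2
  induction n with
  | zero => simp
  | succ n ih =>
    obtain ⟨h1, h2⟩ := ih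
    rw [Finset.sum_range_succ]
    by_cases hp : p n
    · simp only [hp, if_true]
      refine ⟨by rw [pow_succ]; omega, ?_⟩
      rw [add_comm]
      rcases lt_trichotomy i n with h | rfl | h
      · rw [Nat.testBit_two_pow_add_gt h, h2]; simp [h, h.le]
      · rw [Nat.testBit_two_pow_add_eq, Nat.testBit_lt_two_pow h1]; simp [hp]
      · rw [Nat.testBit_lt_two_pow]
        · simp; omega
        · calc _ < 2 ^ (n + 1) := by rw [pow_succ]; omega
            _ ≤ 2 ^ i := Nat.pow_le_pow_right (by omega) h
    · simp only [hp, if_false, add_zero]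
      refine ⟨h1.trans (Nat.pow_lt_pow_right (by omega) (by omega)), h2.trans ?_⟩
      constructor
      · rintro ⟨h, h'⟩; exact ⟨by omega, h'⟩
      · rintro ⟨h, h'⟩
        refine ⟨?_, h'⟩
        rcases Nat.lt_succ_iff_lt_or_eq.1 h with h | rfl
        · exact h
        · exact absurd h' hp

@[simp] theorem testBit_eval_mask (i : ℕ) :
    ((mask n f).eval m E).testBit i = true ↔ i < n.eval m E ∧ f.Holds m (i :: E) := by
  simp only [mask, eval_sum, eval_ite, eval_pow, eval_const, eval_var, List.getD_cons_zero]
  exact testBit_sum_two_pow _ _ _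

/-! ### Loop bounds of the library expressions -/

theorem ok_add (ha : a.Ok T m E) (hb : b.Ok T m E) : (add a b).Ok T m E := ⟨ha, hb⟩
theorem ok_sub (ha : a.Ok T m E) (hb : b.Ok T m E) : (sub a b).Ok T m E := ⟨ha, hb⟩
theorem ok_load (ha : a.Ok T m E) : (load a).Ok T m E := ha
theorem ok_not (ha : a.Ok T m E) : (not a).Ok T m E := ⟨trivial, ha⟩
theorem ok_and (ha : a.Ok T m E) (hb : b.Ok T m E) : (and a b).Ok T m E := ⟨ha, hb, trivial⟩
theorem ok_or (ha : a.Ok T m E) (hb : b.Ok T m E) : (or a b).Ok T m E := ⟨ha, trivial, hb⟩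
theorem ok_le (ha : a.Ok T m E) (hb : b.Ok T m E) : (le a b).Ok T m E := ok_not ⟨ha, hb⟩
theorem ok_eq (ha : a.Ok T m E) (hb : b.Ok T m E) : (eq a b).Ok T m E :=
  ok_and (ok_le ha hb) (ok_le hb ha)

theorem ok_mul (ha : a.Ok T m E) (hb : b.Ok T m E) (h : b.eval m E ≤ T) : (mul a b).Ok T m E :=
  ⟨hb, trivial, h, fun _ _ => ⟨trivial, ha⟩⟩

theorem ok_pow (ha : a.Ok T m E) (hb : b.Ok T m E) (h : b.eval m E ≤ T) (h' : a.eval m E ≤ T) :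
    (pow a b).Ok T m E :=
  ⟨hb, trivial, h, fun _ _ => ok_mul trivial ha h'⟩

theorem ok_div (ha : a.Ok T m E) (hb : b.Ok T m E) (h : a.eval m E ≤ T) (h' : b.eval m E ≤ T) :
    (div a b).Ok T m E :=
  ⟨ha, trivial, h, fun _ _ => ⟨ok_le (ok_mul ⟨trivial, trivial⟩ hb h') ha, ⟨trivial, trivial⟩,
    trivial⟩⟩

theorem ok_mod (ha : a.Ok T m E) (hb : b.Ok T m E) (h : a.eval m E ≤ T) (h' : b.eval m E ≤ T) :
    (mod a b).Ok T m E :=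
  ok_sub ha (ok_mul (ok_div ha hb h h') hb h')

theorem ok_bit (ha : a.Ok T m E) (hb : b.Ok T m E) (h : b.eval m E ≤ T) : (bit a b).Ok T m E :=
  ⟨⟨hb, ha, h, fun _ _ => trivial⟩, trivial, trivial, trivial⟩

theorem ok_sum (hn : n.Ok T m E) (h : n.eval m E ≤ T)
    (hf : ∀ i < n.eval m E, f.Ok T m (i :: E)) : (sum n f).Ok T m E :=
  ⟨hn, trivial, h, fun i hi => ⟨trivial, hf i hi⟩⟩

theorem ok_ex (hn : n.Ok T m E) (h : n.eval m E ≤ T)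
    (hf : ∀ i < n.eval m E, f.Ok T m (i :: E)) : (ex n f).Ok T m E :=
  ⟨hn, trivial, h, fun i hi => ⟨hf i hi, trivial, trivial⟩⟩

theorem ok_max (hn : n.Ok T m E) (h : n.eval m E ≤ T)
    (hf : ∀ i < n.eval m E, f.Ok T m (i :: E)) : (max n f).Ok T m E :=
  ⟨hn, trivial, h, fun i hi => ⟨trivial, hf i hi, trivial⟩⟩

theorem ok_count (hn : n.Ok T m E) (h : n.eval m E ≤ T)
    (hf : ∀ i < n.eval m E, f.Ok T m (i :: E)) : (count n f).Ok T m E :=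
  ok_sum hn h fun i hi => ⟨hf i hi, trivial, trivial⟩

theorem ok_mask (hn : n.Ok T m E) (h : n.eval m E ≤ T) (h2 : 2 ≤ T)
    (hf : ∀ i < n.eval m E, f.Ok T m (i :: E)) : (mask n f).Ok T m E :=
  ok_sum hn h fun i hi =>
    ⟨hf i hi, ok_pow trivial trivial (le_trans (le_of_lt hi) h) h2, trivial⟩

end RAM.Expr

/-! ## Paths, good vertices and classes of vertices -/

/-- Elements outside `A` are never adjacent, so they exceed those in `A` by at most one. The count
is first made with multiplicity, dropping two entries at a time; only the comparison with `A.card`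
needs `Nodup`. -/
theorem List.IsChain.length_le_two_mul_card {α : Type*} [DecidableEq α] {A : Finset α} :
    ∀ {l : List α}, l.IsChain (fun x y => x ∈ A ∨ y ∈ A) → l.Nodup → l.length ≤ 2 * A.card + 1 := by
  have key : ∀ l : List α, l.IsChain (fun x y => x ∈ A ∨ y ∈ A) →
      l.length ≤ 2 * (l.filter (· ∈ A)).length + 1 := by
    intro l
    induction l using List.twoStepInduction with
    | nil => simp
    | singleton x => simp
    | cons_cons x y l ih _ =>
      intro h
      rw [List.isChain_cons_cons] at h
      have h1 := ih h.2.tail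
      simp only [List.filter_cons, List.length_cons]
      rcases h.1 with h | h <;> simp only [h, decide_true, if_true] <;> split_ifs <;> simp <;> omega
  intro l h hl
  refine (key l h).trans ?_
  have : (l.filter (· ∈ A)).length ≤ A.card := by
    rw [← List.toFinset_card_of_nodup (hl.filter _)]
    exact Finset.card_le_card fun x hx => by simp at hx; exact hx.2
  omega

namespace MaxCDP.Instance

variable (I : Instance)

/-- The color `c` is assigned to the edge `uv`. -/
def HasColor (c : Fin I.q) (u v : Fin I.n) : Prop :=
  ∃ h : I.G.Adj u v, c ∈ I.color ⟨s(u, v), h⟩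

/-- `s`, `v`, `t` is a uni-color path. -/
def Good (v : Fin I.n) : Prop :=
  v ≠ I.s ∧ v ≠ I.t ∧ ∃ c, I.HasColor c I.s v ∧ I.HasColor c v I.t

/-- `s`, `t` is a uni-color path. -/
def Direct : Prop := ∃ c, I.HasColor c I.s I.t

/-- `v` is an inner vertex of the path `p`. -/
def Inner (p : I.G.Path I.s I.t) (v : Fin I.n) : Prop :=
  v ∈ p.1.support ∧ v ≠ I.s ∧ v ≠ I.t

/-- `v` may be used in class `i` of the partition `h`. -/
def Allowed (h : Fin I.n → ℕ) (i : ℕ) (v : Fin I.n) : Prop :=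
  v ≠ I.s ∧ v ≠ I.t ∧ ¬ I.Good v ∧ h v = i

/-- `v` can be reached from `s` in `k` rounds, through class `i` and edges of color `c`. -/
def Reach (h : Fin I.n → ℕ) (i : ℕ) (c : Fin I.q) : ℕ → Fin I.n → Prop
  | 0, v => v = I.s
  | k + 1, v => Reach h i c k v ∨ (I.Allowed h i v ∧ ∃ u, Reach h i c k u ∧ I.HasColor c u v)

/-- There is a uni-color path through class `i`. -/
def Linked (h : Fin I.n → ℕ) (i : ℕ) : Prop :=
  ∃ c u, u ≠ I.s ∧ I.Reach h i c I.n u ∧ I.HasColor c u I.t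

open Classical in
/-- The number of disjoint uni-color paths that are found with the partition `h`. -/
noncomputable def value (h : Fin I.n → ℕ) (N : ℕ) : ℕ :=
  (if I.Direct then 1 else 0) + (Finset.univ.filter fun v => I.Good v).card +
    ((Finset.range N).filter fun i => I.Linked h i).card

variable {I}

theorem HasColor.symm {c : Fin I.q} {u v : Fin I.n} (h : I.HasColor c u v) : I.HasColor c v u := by
  obtain ⟨h, hc⟩ := h
  refine ⟨h.symm, ?_⟩
  convert hc using 2
  exact Subtype.ext Sym2.eq_swap

theorem HasColor.adj {c : Fin I.q} {u v : Fin I.n} (h : I.HasColor c u v) : I.G.Adj u v := h.1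

theorem uniColor_iff {p : I.G.Path I.s I.t} :
    I.UniColor p ↔ ∃ c, ∀ u v, s(u, v) ∈ p.1.edges → I.HasColor c u v := by
  refine exists_congr fun c => ⟨fun h u v he => ⟨p.1.edges_subset_edgeSet he, h _ he⟩, ?_⟩
  intro h e
  induction e with
  | _ u v => exact fun he => (h u v he).2

theorem one_le_length (p : I.G.Path I.s I.t) : 1 ≤ p.1.length := by
  by_contra h
  exact I.s_ne_t (p.1.eq_of_length_eq_zero (by omega))

/-- The second vertex of the path is `t` or an inner vertex. -/
theorem edge_mem_or_inner (p : I.G.Path I.s I.t) :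
    s(I.s, I.t) ∈ p.1.edges ∨ I.Inner p (p.1.getVert 1) := by
  have h1 := one_le_length p
  by_cases h : p.1.getVert 1 = I.t
  · left
    rw [SimpleGraph.Walk.mk_mem_edges_iff_exists]
    exact ⟨0, h1, by simp [h]⟩
  · refine .inr ⟨p.1.getVert_mem_support 1, ?_, h⟩
    rw [Ne, p.2.getVert_eq_start_iff h1]
    simp

theorem two_le_length {p : I.G.Path I.s I.t} {v : Fin I.n} (hv : I.Inner p v) :
    2 ≤ p.1.length := by
  obtain ⟨h, hs, ht⟩ := hv
  obtain ⟨k, rfl, hk⟩ := SimpleGraph.Walk.mem_support_iff_exists_getVert.1 h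
  have h0 : k ≠ 0 := by rintro rfl; simp at hs
  have h1 : k ≠ p.1.length := by rintro rfl; simp at ht
  omega

theorem inner_getVert (p : I.G.Path I.s I.t) {k : ℕ} (h0 : k ≠ 0) (hk : k < p.1.length) :
    I.Inner p (p.1.getVert k) :=
  ⟨p.1.getVert_mem_support k, by rwa [Ne, p.2.getVert_eq_start_iff hk.le],
    by rw [Ne, p.2.getVert_eq_end_iff hk.le]; omega⟩

/-- Injectivity is a separate hypothesis because the direct path has no inner vertices, so that
disjointness does not prevent it from occurring twice. -/
theorem card_le_opt {ι : Type*} (J : Finset ι) (P : ι → I.G.Path I.s I.t)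
    (hu : ∀ i ∈ J, I.UniColor (P i)) (hi : Set.InjOn P J)
    (hd : ∀ i ∈ J, ∀ j ∈ J, i ≠ j → ∀ v, I.Inner (P i) v → ¬ I.Inner (P j) v) :
    J.card ≤ I.opt := by
  classical
  refine I.isGreatest_opt.2 ⟨J.image P, ⟨?_, ?_⟩, Finset.card_image_of_injOn hi⟩
  · simpa using hu
  · intro p hp p' hp' hne x hx hx'
    obtain ⟨i, hi, rfl⟩ := Finset.mem_image.1 hp
    obtain ⟨j, hj, rfl⟩ := Finset.mem_image.1 hp'
    by_contra! h
    exact hd i hi j hj (fun h => hne (h ▸ rfl)) x ⟨hx, h⟩ ⟨hx', h⟩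

/-! ### From partitions to solutions -/

theorem exists_path_of_direct (h : I.Direct) :
    ∃ p, I.UniColor p ∧ ∀ v, ¬ I.Inner p v := by
  obtain ⟨c, hc⟩ := h
  refine ⟨SimpleGraph.Path.singleton hc.adj, uniColor_iff.2 ⟨c, fun u v he => ?_⟩, ?_⟩
  · simp [SimpleGraph.Path.singleton] at he
    rcases he with ⟨rfl, rfl⟩ | ⟨rfl, rfl⟩
    · exact hc
    · exact hc.symm
  · rintro v ⟨hv, hs, ht⟩
    simp [SimpleGraph.Path.singleton] at hv
    tauto

theorem exists_path_of_good {v : Fin I.n} (h : I.Good v) :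
    ∃ p, I.UniColor p ∧ ∀ w, I.Inner p w ↔ w = v := by
  obtain ⟨hs, ht, c, h1, h2⟩ := h
  refine ⟨⟨.cons h1.adj (.cons h2.adj .nil), ?_⟩, uniColor_iff.2 ⟨c, fun u w he => ?_⟩, ?_⟩
  · simp [hs.symm, ht, I.s_ne_t]
  · simp at he
    rcases he with (⟨rfl, rfl⟩ | ⟨rfl, rfl⟩) | (⟨rfl, rfl⟩ | ⟨rfl, rfl⟩)
    exacts [h1, h1.symm, h2, h2.symm]
  · intro w
    simp only [Inner, SimpleGraph.Walk.support_cons, SimpleGraph.Walk.support_nil, List.mem_cons,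
      List.not_mem_nil, or_false]
    constructor
    · tauto
    · rintro rfl
      tauto

theorem Reach.exists_walk {h : Fin I.n → ℕ} {i : ℕ} {c : Fin I.q} {k : ℕ} {u : Fin I.n}
    (hr : I.Reach h i c k u) : ∃ w : I.G.Walk I.s u, (∀ x ∈ w.support, x = I.s ∨ I.Allowed h i x) ∧
      ∀ x y, s(x, y) ∈ w.edges → I.HasColor c x y := by
  induction k generalizing u with
  | zero =>
    obtain rfl : u = I.s := hr
    exact ⟨.nil, by simp, by simp⟩
  | succ k ih =>
    rcases hr with hr | ⟨ha, v, hr, hc⟩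
    · exact ih hr
    · obtain ⟨w, h1, h2⟩ := ih hr
      refine ⟨w.concat hc.adj, fun x hx => ?_, fun x y hxy => ?_⟩
      · simp only [SimpleGraph.Walk.support_concat, List.mem_append,
          List.mem_singleton] at hx
        rcases hx with hx | rfl
        · exact h1 x hx
        · exact .inr ha
      · simp only [SimpleGraph.Walk.edges_concat, List.concat_eq_append, List.mem_append,
          List.mem_singleton, Sym2.eq_iff] at hxy
        rcases hxy with hxy | ⟨rfl, rfl⟩ | ⟨rfl, rfl⟩
        exacts [h2 x y hxy, hc, hc.symm]

/-- Shortening a walk to a path only removes vertices and edges, so the color and the class are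
kept. -/
theorem exists_path_of_linked {h : Fin I.n → ℕ} {i : ℕ} (hl : I.Linked h i) :
    ∃ p, I.UniColor p ∧ (∃ w, I.Inner p w) ∧ ∀ w, I.Inner p w → I.Allowed h i w := by
  obtain ⟨c, u, hu, hr, hc⟩ := hl
  obtain ⟨w, h1, h2⟩ := hr.exists_walk
  have hsub := SimpleGraph.Walk.support_toPath_subset_support (w.concat hc.adj)
  have esub := SimpleGraph.Walk.edges_toPath_subset_edges (w.concat hc.adj)
  refine ⟨(w.concat hc.adj).toPath, uniColor_iff.2 ⟨c, fun x y hxy => ?_⟩, ?_, ?_⟩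
  · have hxy := esub hxy
    simp only [SimpleGraph.Walk.edges_concat, List.concat_eq_append, List.mem_append,
      List.mem_singleton, Sym2.eq_iff] at hxy
    rcases hxy with hxy | ⟨rfl, rfl⟩ | ⟨rfl, rfl⟩
    exacts [h2 x y hxy, hc, hc.symm]
  -- The path has an inner vertex since the edge `st` does not occur: the walk `w` avoids `t`, and
  -- the last edge starts at `u ≠ s`.
  · rcases edge_mem_or_inner (w.concat hc.adj).toPath with he | hi
    · have hxy := esub he
      simp only [SimpleGraph.Walk.edges_concat, List.concat_eq_append, List.mem_append,
        List.mem_singleton, Sym2.eq_iff] at hxy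
      rcases hxy with hxy | ⟨h, -⟩ | ⟨h, -⟩
      · rcases h1 _ (w.snd_mem_support_of_mem_edges hxy) with h | h
        · exact absurd h.symm I.s_ne_t
        · exact absurd rfl h.2.1
      · exact absurd h.symm hu
      · exact absurd h I.s_ne_t
    · exact ⟨_, hi⟩
  · rintro x ⟨hx, hs, ht⟩
    have hx := hsub hx
    simp only [SimpleGraph.Walk.support_concat, List.mem_append,
      List.mem_singleton] at hx
    rcases hx with hx | hx
    · exact (h1 x hx).resolve_left hs
    · exact absurd hx ht

/-- The paths that are found with any partition form a solution. -/
theorem value_le_opt (h : Fin I.n → ℕ) (N : ℕ) : I.value h N ≤ I.opt := by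
  classical
  -- `J` indexes the paths to be chosen: the direct one, one for each good vertex, one for each
  -- linked class. `Z` reserves pairwise disjoint sets of inner vertices for them.
  let J : Finset (Unit ⊕ Fin I.n ⊕ ℕ) :=
    (if I.Direct then {()} else ∅ : Finset Unit).disjSum
      ((Finset.univ.filter fun v => I.Good v).disjSum ((Finset.range N).filter fun i => I.Linked h i))
  let Z : Unit ⊕ Fin I.n ⊕ ℕ → Fin I.n → Prop :=
    Sum.elim (fun _ _ => False) (Sum.elim (fun v w => w = v) (fun i w => I.Allowed h i w))
  have hJ : I.value h N = J.card := by
    simp only [J, value, Finset.card_disjSum, add_assoc]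
    split_ifs <;> rfl
  have hZ : ∀ x ∈ J, ∀ y ∈ J, x ≠ y → ∀ w, Z x w → ¬ Z y w := by
    rintro (x | x | x) hx (y | y | y) hy hne w h1 h2 <;> simp [Z, J] at h1 h2 hx hy hne
    · exact hne (h1.symm.trans h2)
    · subst h1; exact h2.2.2.1 hx
    · subst h2; exact h1.2.2.1 hy
    · exact hne (h1.2.2.2.symm.trans h2.2.2.2)
  have hP : ∀ x ∈ J, ∃ p, I.UniColor p ∧ (∀ w, I.Inner p w → Z x w) ∧
      (x ≠ .inl () → ∃ w, I.Inner p w) := by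
    rintro (x | x | x) hx
    · have : I.Direct := by
        by_contra h
        simp [J, h] at hx
      obtain ⟨p, h1, h2⟩ := exists_path_of_direct this
      exact ⟨p, h1, fun w hw => h2 w hw, by simp⟩
    · obtain ⟨p, h1, h2⟩ := exists_path_of_good (show I.Good x by simpa [J] using hx)
      exact ⟨p, h1, fun w hw => (h2 w).1 hw, fun _ => ⟨x, (h2 x).2 rfl⟩⟩
    · obtain ⟨p, h1, h2, h3⟩ := exists_path_of_linked (h := h) (i := x)
        (by simp [J] at hx; exact hx.2)
      exact ⟨p, h1, fun w hw => h3 w hw, fun _ => h2⟩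
  have hP' : ∀ x : J, ∃ p, I.UniColor p ∧ (∀ w, I.Inner p w → Z x w) ∧
      (x.1 ≠ .inl () → ∃ w, I.Inner p w) := fun x => hP x x.2
  choose P h1 h2 h3 using hP'
  rw [hJ, ← J.card_attach]
  have hd : ∀ x y : J, x ≠ y → ∀ v, I.Inner (P x) v → ¬ I.Inner (P y) v := fun x y hne v hx hy =>
    hZ x x.2 y y.2 (fun h => hne (Subtype.ext h)) v (h2 x v hx) (h2 y v hy)
  refine card_le_opt J.attach P (fun x _ => h1 x) ?_ fun x _ y _ => hd x y
  intro x _ y _ hxy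
  by_contra hne
  -- Of two different indices, one is not that of the direct path. If their paths coincided, an
  -- inner vertex of the common path would lie in two reserved sets.
  by_cases hx : x.1 = .inl ()
  · obtain ⟨w, hw⟩ := h3 y fun hy => hne (Subtype.ext (hx.trans hy.symm))
    exact hd x y hne w (hxy ▸ hw) hw
  · obtain ⟨w, hw⟩ := h3 x hx
    exact hd x y hne w hw (hxy ▸ hw)

/-! ### From optimal solutions to partitions -/

theorem reach_mono {h : Fin I.n → ℕ} {i : ℕ} {c : Fin I.q} {k l : ℕ} (hkl : k ≤ l) {u : Fin I.n}
    (hr : I.Reach h i c k u) : I.Reach h i c l u := by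
  induction hkl with
  | refl => exact hr
  | step _ ih => exact .inl ih

/-- The vertex at position `k` of the path is reached after `k` rounds, and a path has at most `n`
vertices, so `n` rounds lead to its last inner vertex. -/
theorem linked_of_path {h : Fin I.n → ℕ} {i : ℕ} {p : I.G.Path I.s I.t} (hu : I.UniColor p)
    {v : Fin I.n} (hv : I.Inner p v) (ha : ∀ w, I.Inner p w → I.Allowed h i w) : I.Linked h i := by
  obtain ⟨c, hc⟩ := uniColor_iff.1 hu
  have h2 := two_le_length hv
  have hc' : ∀ k < p.1.length, I.HasColor c (p.1.getVert k) (p.1.getVert (k + 1)) := fun k hk =>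
    hc _ _ ((SimpleGraph.Walk.mk_mem_edges_iff_exists _).2 ⟨k, hk, rfl⟩)
  have key : ∀ k < p.1.length, I.Reach h i c k (p.1.getVert k) := by
    intro k
    induction k with
    | zero => intro _; exact p.1.getVert_zero
    | succ k ih =>
      intro hk
      exact .inr ⟨ha _ (inner_getVert p (by omega) hk), _, ih (by omega), hc' k (by omega)⟩
  have hn : p.1.length ≤ I.n := by simpa using p.2.length_lt.le
  refine ⟨c, p.1.getVert (p.1.length - 1), (inner_getVert p (by omega) (by omega)).2.1,
    reach_mono (by omega) (key _ (by omega)), ?_⟩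
  have := hc' (p.1.length - 1) (by omega)
  rwa [Nat.sub_add_cancel (by omega), p.1.getVert_length] at this

/-- If the length is two, the only inner vertex is good, which is excluded. Otherwise the second
edge joins two inner vertices, and the cover contains one of them. -/
theorem exists_inner_mem_cover {A : Finset (Fin I.n)} (hA : ∀ u v, I.G.Adj u v → u ∈ A ∨ v ∈ A)
    {p : I.G.Path I.s I.t} (hu : I.UniColor p) {v : Fin I.n} (hv : I.Inner p v)
    (hg : ∀ w, I.Inner p w → ¬ I.Good w) : ∃ w, I.Inner p w ∧ w ∈ A := by
  obtain ⟨c, hc⟩ := uniColor_iff.1 hu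
  have h2 := two_le_length hv
  have hc' : ∀ k < p.1.length, I.HasColor c (p.1.getVert k) (p.1.getVert (k + 1)) := fun k hk =>
    hc _ _ ((SimpleGraph.Walk.mk_mem_edges_iff_exists _).2 ⟨k, hk, rfl⟩)
  have h1 := inner_getVert p one_ne_zero (by omega)
  rcases h2.eq_or_lt with h2 | h2
  · refine absurd ⟨h1.2.1, h1.2.2, c, ?_, ?_⟩ (hg _ h1)
    · simpa using hc' 0 (by omega)
    · have := hc' 1 (by omega)
      rwa [show 1 + 1 = p.1.length by omega, p.1.getVert_length] at this
  · rcases hA _ _ (hc' 1 (by omega)).adj with h | h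
    · exact ⟨_, h1, h⟩
    · exact ⟨_, inner_getVert p (by omega) h2, h⟩

/-- A partition that separates a bounded number of vertices in the right way finds an optimal
solution. -/
theorem exists_partition (A : Finset (Fin I.n)) (hA : ∀ u v, I.G.Adj u v → u ∈ A ∨ v ∈ A) :
    ∃ (U : Finset (Fin I.n)) (g : Fin I.n → ℕ), U.card ≤ A.card * (2 * A.card + 1) ∧
      (∀ v ∈ U, g v < A.card) ∧
      ∀ h : Fin I.n → ℕ, (∀ v ∈ U, h v = g v) → I.opt ≤ I.value h A.card := by
  classical
  obtain ⟨S, ⟨hS1, hS2⟩, hS⟩ := I.isGreatest_opt.1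
  have huniq : ∀ p ∈ S, ∀ p' ∈ S, ∀ v, I.Inner p v → I.Inner p' v → p = p' := by
    intro p hp p' hp' v hv hv'
    by_contra h
    rcases hS2 p hp p' hp' h v hv.1 hv'.1 with h | h
    exacts [hv.2.1 h, hv.2.2 h]
  -- Inner vertices determine their path, so choosing one in `B` for each path is injective.
  have hcard : ∀ (S' : Finset (I.G.Path I.s I.t)) (B : Finset (Fin I.n)), S' ⊆ S →
      (∀ p ∈ S', ∃ v, I.Inner p v ∧ v ∈ B) → S'.card ≤ B.card := by
    intro S' B hsub h
    have h' : ∀ p : S', ∃ v, I.Inner p.1 v ∧ v ∈ B := fun p => h p p.2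
    choose f hf1 hf2 using h'
    rw [← S'.card_attach]
    refine Finset.card_le_card_of_injOn f (fun p _ => hf2 p) fun p _ p' _ hp => ?_
    exact Subtype.ext (huniq p (hsub p.2) p' (hsub p'.2) _ (hf1 p) (hp ▸ hf1 p'))
  -- The three kinds of paths: without inner vertices, through a good vertex, and the rest. They are
  -- matched with the three summands of `value`.
  let S0 := S.filter fun p => ∀ v, ¬ I.Inner p v
  let S1 := S.filter fun p => ∃ v, I.Inner p v ∧ I.Good v
  let S2 := S.filter fun p => (∃ v, I.Inner p v) ∧ ∀ v, I.Inner p v → ¬ I.Good v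
  have hS012 : S.card ≤ S0.card + S1.card + S2.card := by
    have : S ⊆ S0 ∪ S1 ∪ S2 := by
      intro p hp
      simp only [S0, S1, S2, Finset.mem_union, Finset.mem_filter, hp, true_and]
      by_cases h : ∃ v, I.Inner p v
      · by_cases h' : ∃ v, I.Inner p v ∧ I.Good v
        · exact .inl (.inr h')
        · exact .inr ⟨h, fun v hv hg => h' ⟨v, hv, hg⟩⟩
      · exact .inl (.inl (not_exists.1 h))
    exact (Finset.card_le_card this).trans ((Finset.card_union_le _ _).trans
      (Nat.add_le_add_right (Finset.card_union_le _ _) _))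
  have h0 : S0.card ≤ if I.Direct then 1 else 0 := by
    have hedge : ∀ p ∈ S0, s(I.s, I.t) ∈ p.1.edges := fun p hp =>
      (edge_mem_or_inner p).resolve_right ((Finset.mem_filter.1 hp).2 _)
    split_ifs with hD
    · obtain ⟨c, hD⟩ := hD
      refine Finset.card_le_one.2 fun p hp p' hp' => Subtype.ext ?_
      have e : ∀ p ∈ S0, p.1 = .cons hD.adj .nil := by
        intro p hp
        have hl := p.2.length_eq_one_of_mem_edges (hedge p hp)
        refine p.1.ext_getVert_le_length (by simp [hl]) fun k hk => ?_
        obtain rfl | rfl : k = 0 ∨ k = 1 := by omega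
        · simp
        · conv_lhs => rw [← hl, p.1.getVert_length]
          simp
      rw [e p hp, e p' hp']
    · rw [Nat.le_zero, Finset.card_eq_zero, Finset.eq_empty_iff_forall_notMem]
      intro p hp
      obtain ⟨c, hc⟩ := uniColor_iff.1 (hS1 p (Finset.mem_filter.1 hp).1)
      exact hD ⟨c, hc _ _ (hedge p hp)⟩
  have h1 : S1.card ≤ (Finset.univ.filter fun v => I.Good v).card :=
    hcard S1 _ (Finset.filter_subset _ _) fun p hp => by
      obtain ⟨v, hv, hg⟩ := (Finset.mem_filter.1 hp).2
      exact ⟨v, hv, by simpa using hg⟩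
  have h2 : S2.card ≤ A.card := hcard S2 _ (Finset.filter_subset _ _) fun p hp => by
    obtain ⟨hp, ⟨v, hv⟩, hg⟩ := Finset.mem_filter.1 hp
    exact exists_inner_mem_cover hA (hS1 p hp) hv hg
  -- The paths of the third kind are numbered; `U` consists of their inner vertices, and `g` maps
  -- each of these to the number of its path. The value `0` elsewhere is irrelevant.
  let e := S2.equivFin
  let U := S2.biUnion fun p => Finset.univ.filter fun v => I.Inner p v
  let g : Fin I.n → ℕ := fun v =>
    if h : ∃ p ∈ S2, I.Inner p v then (e ⟨h.choose, h.choose_spec.1⟩ : ℕ) else 0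
  have hg : ∀ p (hp : p ∈ S2) v, I.Inner p v → g v = e ⟨p, hp⟩ := by
    intro p hp v hv
    have h : ∃ p ∈ S2, I.Inner p v := ⟨p, hp, hv⟩
    have : h.choose = p := huniq _ (Finset.mem_filter.1 h.choose_spec.1).1 _
      (Finset.mem_filter.1 hp).1 v h.choose_spec.2 hv
    simp only [g, h, dite_true, this]
  refine ⟨U, g, ?_, ?_, ?_⟩
  · refine (Finset.card_biUnion_le_card_mul _ _ (2 * A.card + 1) fun p _ => ?_).trans
      (Nat.mul_le_mul_right _ h2)
    calc _ ≤ p.1.support.toFinset.card := Finset.card_le_card fun v hv => by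
          simpa using (Finset.mem_filter.1 hv).2.1
      _ ≤ p.1.support.length := List.toFinset_card_le _
      _ ≤ _ := (p.1.isChain_adj_support.imp fun u v huv => hA u v huv).length_le_two_mul_card
          p.2.support_nodup
  · intro v hv
    obtain ⟨p, hp, hv⟩ := Finset.mem_biUnion.1 hv
    rw [hg p hp v (by simpa using hv)]
    exact (e ⟨p, hp⟩).2.trans_le h2
  · intro h hh
    rw [← hS]
    refine hS012.trans (Nat.add_le_add (Nat.add_le_add h0 h1) ?_)
    rw [← S2.card_attach]
    -- Each path of the third kind runs inside the class of its own number, so this class is linked.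
    -- How `h` treats vertices outside `U` does not matter.
    refine Finset.card_le_card_of_injOn (fun p => (e p : ℕ)) (fun p _ => ?_) fun p _ p' _ hpp =>
      e.injective (Fin.ext hpp)
    have hp := (Finset.mem_filter.1 p.2)
    obtain ⟨v, hv⟩ := hp.2.1
    simp only [Finset.coe_filter, Finset.mem_range, Set.mem_ofPred_eq]
    refine ⟨(e p).2.trans_le h2, linked_of_path (hS1 _ hp.1) hv fun w hw => ?_⟩
    refine ⟨hw.2.1, hw.2.2, hp.2.2 w hw, ?_⟩
    rw [hh w (Finset.mem_biUnion.2 ⟨p, p.2, by simpa using hw⟩), hg p p.2 w hw]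

end MaxCDP.Instance

/-! ## Partitions given by numbers -/

namespace MaxCDP

/-- The digit at position `r` of `j` in base `B`. -/
def digit (B j r : ℕ) : ℕ := j / B ^ r % B

/-- The number with the binary digits of `v` at the positions `p 0, …, p (k - 1)`. -/
def selectBits (p : ℕ → ℕ) (v : ℕ) : ℕ → ℕ
  | 0 => 0
  | k + 1 => selectBits p v k + selectBits p v k + v / 2 ^ p k % 2

/-- The class of `v` in the partition with number `j`: the first `M` digits of `j` are positions of
binary digits of `v`, which select one of the following `2 ^ M` digits. -/
def classOf (B M j v : ℕ) : ℕ := digit B j (M + selectBits (digit B j) v M)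

theorem selectBits_lt (p : ℕ → ℕ) (v k : ℕ) : selectBits p v k < 2 ^ k := by
  induction k with
  | zero => simp [selectBits]
  | succ k ih => rw [selectBits, pow_succ]; omega

theorem testBit_eq_of_selectBits_eq {p : ℕ → ℕ} {v w k : ℕ}
    (h : selectBits p v k = selectBits p w k) : ∀ r < k, v.testBit (p r) = w.testBit (p r) := by
  induction k with
  | zero => simp
  | succ k ih =>
    rw [selectBits, selectBits] at h
    intro r hr
    rcases Nat.lt_succ_iff_lt_or_eq.1 hr with hr | rfl
    · exact ih (by omega) r hr
    · simp only [Nat.testBit_eq_decide_div_mod_eq]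
      congr 2
      omega

theorem selectBits_congr {p p' : ℕ → ℕ} {v k : ℕ} (h : ∀ r < k, p r = p' r) :
    selectBits p v k = selectBits p' v k := by
  induction k with
  | zero => rfl
  | succ k ih => rw [selectBits, selectBits, ih fun r hr => h r (by omega), h k (by omega)]

theorem exists_digits {B : ℕ} (L : ℕ) (D : ℕ → ℕ) (hD : ∀ r < L, D r < B) :
    ∃ j < B ^ L, ∀ r < L, digit B j r = D r := by
  induction L generalizing D with
  | zero => exact ⟨0, by simp, by simp⟩
  | succ L ih =>
    obtain ⟨j, hj, h⟩ := ih (fun r => D (r + 1)) fun r hr => hD (r + 1) (by omega)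
    have h0 := hD 0 (by omega)
    refine ⟨D 0 + B * j, ?_, ?_⟩
    · calc D 0 + B * j < B + B * j := by omega
        _ = B * (j + 1) := by ring
        _ ≤ B * B ^ L := Nat.mul_le_mul_left _ hj
        _ = B ^ (L + 1) := by ring
    · rintro (_ | r) hr
      · simp [digit, Nat.mod_eq_of_lt h0]
      · rw [← h r (by omega), digit, digit, pow_succ', ← Nat.div_div_eq_div_mul,
          Nat.add_mul_div_left _ _ (by omega), Nat.div_eq_of_lt h0, zero_add]

/-- Induction on `U`, with one new position per element. The old positions separate `U`, so at most
one `u ∈ U` agrees with the new element `a` on all of them, and a position where `a` and `u` differ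
completes the list. -/
theorem exists_separating_positions {b : ℕ} (hb : 0 < b) (U : Finset ℕ) (hU : ∀ v ∈ U, v < 2 ^ b) :
    ∃ p : ℕ → ℕ, (∀ r, p r < b) ∧ ∀ v ∈ U, ∀ w ∈ U,
      (∀ r < U.card, v.testBit (p r) = w.testBit (p r)) → v = w := by
  induction U using Finset.induction_on with
  | empty => exact ⟨fun _ => 0, fun _ => hb, by simp⟩
  | insert a U ha ih =>
    obtain ⟨p, hp, h⟩ := ih fun v hv => hU v (Finset.mem_insert_of_mem hv)
    have key : ∃ x < b, ∀ u ∈ U, (∀ r < U.card, a.testBit (p r) = u.testBit (p r)) →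
        a.testBit x ≠ u.testBit x := by
      by_cases hu : ∃ u ∈ U, ∀ r < U.card, a.testBit (p r) = u.testBit (p r)
      · obtain ⟨u, hu, hau⟩ := hu
        have hne : a ≠ u := fun h => ha (h ▸ hu)
        obtain ⟨x, hx⟩ := Nat.exists_testBit_ne_of_ne hne
        refine ⟨x, ?_, fun u' hu' hau' => ?_⟩
        · by_contra hxb
          have : ∀ v ∈ insert a U, v.testBit x = false := fun v hv =>
            Nat.testBit_lt_two_pow ((hU v hv).trans_le (Nat.pow_le_pow_right (by omega) (by omega)))
          rw [this a (Finset.mem_insert_self _ _), this u (Finset.mem_insert_of_mem hu)] at hx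
          exact hx rfl
        · rwa [h u' hu' u hu fun r hr => (hau' r hr).symm.trans (hau r hr)]
      · push Not at hu
        exact ⟨0, hb, fun u hu' h => by
          obtain ⟨r, hr, hne⟩ := hu u hu'
          exact absurd (h r hr) hne⟩
    obtain ⟨x, hx, hxu⟩ := key
    rw [Finset.card_insert_of_notMem ha]
    refine ⟨Function.update p U.card x, fun r => ?_, ?_⟩
    · by_cases hr : r = U.card
      · simpa [hr] using hx
      · simpa [hr] using hp r
    · have low : ∀ v w : ℕ, (∀ r < U.card + 1, v.testBit (Function.update p U.card x r) =
          w.testBit (Function.update p U.card x r)) →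
          (∀ r < U.card, v.testBit (p r) = w.testBit (p r)) ∧ v.testBit x = w.testBit x := by
        intro v w hvw
        refine ⟨fun r hr => ?_, by simpa using hvw U.card (by omega)⟩
        simpa [hr.ne] using hvw r (by omega)
      intro v hv w hw hvw
      obtain ⟨h1, h2⟩ := low v w hvw
      rcases Finset.mem_insert.1 hv with hv | hv <;> rcases Finset.mem_insert.1 hw with hw | hw
      · rw [hv, hw]
      · exact absurd (hv ▸ h2) (hxu w hw (hv ▸ h1))
      · exact absurd (hw ▸ h2.symm) (hxu v hv fun r hr => (hw ▸ h1 r hr).symm)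
      · exact h v hv w hw h1

/-- Every partition of a set of at most `M` numbers is given by the number of a partition. -/
theorem exists_classOf {b B M : ℕ} (hb : 0 < b) (hbB : b ≤ B) (U : Finset ℕ) (hM : U.card ≤ M)
    (hU : ∀ v ∈ U, v < 2 ^ b) (g : ℕ → ℕ) (hg : ∀ v ∈ U, g v < B) :
    ∃ j < B ^ (M + 2 ^ M), ∀ v ∈ U, classOf B M j v = g v := by
  classical
  obtain ⟨p, hp, hsep⟩ := exists_separating_positions hb U hU
  -- The first `M` digits are the separating positions. The digit at position `M + x` is the value
  -- of `g` at an element of `U` with selected bits `x`, if there is one; unused entries are `0`.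
  obtain ⟨j, hj, hd⟩ := exists_digits (B := B) (M + 2 ^ M) (fun r => if r < M then p r else
      if h : ∃ v ∈ U, M + selectBits p v M = r then g h.choose else 0) (by
    intro r _
    split_ifs with h1 h2
    · exact (hp r).trans_le hbB
    · exact hg _ h2.choose_spec.1
    · omega)
  refine ⟨j, hj, fun v hv => ?_⟩
  have hsel : selectBits (digit B j) v M = selectBits p v M := selectBits_congr fun r hr => by
    rw [hd r (Nat.lt_add_right _ hr), if_pos hr]
  rw [classOf, hsel, hd _ (Nat.add_lt_add_left (selectBits_lt _ _ _) _), if_neg (by omega)]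
  have h : ∃ w ∈ U, M + selectBits p w M = M + selectBits p v M := ⟨v, hv, rfl⟩
  rw [dif_pos h]
  congr 1
  -- The element chosen for the table entry has the same selected bits as `v`; as `U.card ≤ M`,
  -- these include all separating positions.
  refine hsep _ h.choose_spec.1 v hv fun r hr => ?_
  exact testBit_eq_of_selectBits_eq (Nat.add_left_cancel h.choose_spec.2) r (by omega)

/-! ## The algorithm -/

open RAM RAM.Expr

/-- The memory `m` starts with the encoding of `I`. -/
structure Encodes (m : ℕ → ℕ) (I : Instance) : Prop where
  n : m 0 = I.n
  q : m 1 = I.q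
  s : m 2 = I.s
  t : m 3 = I.t
  adj : ∀ u v : Fin I.n, m (4 + (u * I.n + v)) = I.adjBit u v
  color : ∀ (c : Fin I.q) (u v : Fin I.n),
    m (4 + I.n * I.n + ((c * I.n + u) * I.n + v)) = I.colorBit c u v

namespace Algo

/-- The number of vertices. -/
def n : Expr := load (const 0)
/-- The number of colors. -/
def q : Expr := load (const 1)
/-- The start of the paths. -/
def s : Expr := load (const 2)
/-- The end of the paths. -/
def t : Expr := load (const 3)
/-- Adjacency. -/
def adj (u v : Expr) : Expr := load (add (const 4) (add (mul u n) v))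
/-- The edge `uv` has color `c`. -/
def color (c u v : Expr) : Expr :=
  load (add (add (const 4) (mul n n)) (add (mul (add (mul c n) u) n) v))
/-- See `Instance.Good`. -/
def good (v : Expr) : Expr :=
  and (not (eq v s)) (and (not (eq v t))
    (ex q (and (color (var 0) s (lift 1 v)) (color (var 0) (lift 1 v) t))))
/-- See `Instance.Direct`. -/
def direct : Expr := ex q (color (var 0) s t)
/-- One step of the greedy algorithm for a vertex cover. -/
def coverStep : Expr :=
  ite (and (adj (var 3) (var 1)) (and (not (bit (var 0) (var 3))) (not (bit (var 0) (var 1)))))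
    (mask n (or (bit (var 1) (var 0)) (or (eq (var 0) (var 4)) (eq (var 0) (var 2))))) (var 0)
/-- The set of the vertices of a maximal matching. -/
def cover : Expr := fold n (const 0) (fold n (var 0) coverStep)
/-- The size of this vertex cover. -/
def size : Expr := count n (bit cover (var 0))
/-- A bound for the number of vertices to be separated. -/
def positions : Expr := mul size (add (add size size) (const 1))
/-- The number of digits of the numbers of partitions. -/
def digits : Expr := add positions (pow (const 2) positions)
/-- The base of the numbers of partitions. -/
def base : Expr := add size (count n (le (pow (const 2) (var 0)) n))
/-- See `MaxCDP.digit`. -/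
def digit (j r : Expr) : Expr := mod (div j (pow base r)) base
/-- See `MaxCDP.selectBits`. -/
def selectBits (j v : Expr) : Expr :=
  fold positions (const 0)
    (add (add (var 0) (var 0)) (bit (lift 2 v) (digit (lift 2 j) (var 1))))
/-- See `MaxCDP.classOf`. -/
def classOf (j v : Expr) : Expr := digit j (add positions (selectBits j v))
/-- See `Instance.Allowed`. -/
def allowed (j i v : Expr) : Expr :=
  and (not (eq v s)) (and (not (eq v t)) (and (not (good v)) (eq (classOf j v) i)))
/-- See `Instance.Reach`. -/
def reach (j i c : Expr) : Expr :=
  fold n (pow (const 2) s) (mask n (or (bit (var 1) (var 0))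
    (and (allowed (lift 3 j) (lift 3 i) (var 0))
      (ex n (and (bit (var 2) (var 0)) (color (lift 4 c) (var 0) (var 1)))))))
/-- See `Instance.Linked`. -/
def linked (j i : Expr) : Expr :=
  ex q (ex n (and (not (eq (var 0) s)) (and (bit (reach (lift 2 j) (lift 2 i) (var 1)) (var 0))
    (color (var 1) (var 0) t))))
/-- The maximum number of disjoint uni-color paths. -/
def opt : Expr :=
  add (ite direct (const 1) (const 0)) (add (count n (good (var 0)))
    (max (pow base digits) (count size (linked (var 1) (var 0)))))
/-- The answer to the decision problem. -/
def decide : Expr :=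
  not (sub (load (add (add (const 4) (mul n n)) (mul (mul q n) n))) opt)

end Algo

open Algo

theorem card_filter_range (n : ℕ) (p : ℕ → Prop) [DecidablePred p] :
    ((Finset.range n).filter p).card = (Finset.univ.filter fun v : Fin n => p v).card := by
  simp only [Finset.card_filter]
  exact (Fin.sum_univ_eq_sum_range (fun i => if p i then 1 else 0) n).symm

/-- The value of `Algo.size`. -/
def coverSize (m : ℕ → ℕ) : ℕ := Algo.size.eval m []
/-- The value of `Algo.positions`. -/
def numPositions (m : ℕ → ℕ) : ℕ := coverSize m * (coverSize m + coverSize m + 1)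
/-- The value of `Algo.digits`. -/
def numDigits (m : ℕ → ℕ) : ℕ := numPositions m + 2 ^ numPositions m
/-- The value of `Algo.base`. -/
def baseOf (m : ℕ → ℕ) : ℕ := coverSize m + Nat.size (m 0)

/-! ### Correctness of the algorithm -/

section

variable {m : ℕ → ℕ} {E : List ℕ}

@[simp] theorem eval_n : Algo.n.eval m E = m 0 := rfl
@[simp] theorem eval_q : Algo.q.eval m E = m 1 := rfl
@[simp] theorem eval_s : Algo.s.eval m E = m 2 := rfl
@[simp] theorem eval_t : Algo.t.eval m E = m 3 := rfl
-- The expression is closed: all its variables are bound by its own loops.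
theorem eval_cover : Algo.cover.eval m E = Algo.cover.eval m [] := rfl

@[simp] theorem eval_size : Algo.size.eval m E = coverSize m := by
  simp only [coverSize, Algo.size, eval_count, holds_bit, eval_cover (E := _ :: _)]
  rfl

@[simp] theorem eval_positions : Algo.positions.eval m E = numPositions m := by
  simp [Algo.positions, numPositions]

@[simp] theorem eval_digits : Algo.digits.eval m E = numDigits m := by
  simp [Algo.digits, numDigits]

@[simp] theorem eval_base : Algo.base.eval m E = baseOf m := by
  simp only [Algo.base, baseOf, eval_add, eval_size, eval_count, eval_n, holds_le, eval_pow,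
    eval_const, eval_var, List.getD_cons_zero]
  congr 1
  -- Since `i < 2 ^ i`, every `i` with `2 ^ i ≤ n` is below `n`, so the search range loses nothing.
  have h : (Finset.range (m 0)).filter (fun i => 2 ^ i ≤ m 0) = Finset.range (Nat.size (m 0)) := by
    ext i
    simp only [Finset.mem_filter, Finset.mem_range, Nat.lt_size]
    exact ⟨fun h => h.2, fun h => ⟨Nat.lt_two_pow_self.trans_le h, h⟩⟩
  rw [h, Finset.card_range]

end

section

variable {m : ℕ → ℕ} {I : Instance} (hm : Encodes m I) {E : List ℕ}
include hm

theorem baseOf_pos : 0 < baseOf m := by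
  have : 0 < Nat.size (m 0) := Nat.size_pos.2 (by rw [hm.n]; exact I.s.pos)
  exact Nat.add_pos_right _ this

theorem holds_adj {u v : Expr} {a b : Fin I.n} (ha : u.eval m E = a) (hb : v.eval m E = b) :
    (Algo.adj u v).Holds m E ↔ I.G.Adj a b := by
  simp [Algo.adj, Holds, ha, hb, hm.n, hm.adj, Instance.adjBit]

theorem holds_color {c u v : Expr} {x : Fin I.q} {a b : Fin I.n} (hx : c.eval m E = x)
    (ha : u.eval m E = a) (hb : v.eval m E = b) :
    (Algo.color c u v).Holds m E ↔ I.HasColor x a b := by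
  simp only [Algo.color, Holds, eval_load, eval_add, eval_const, eval_mul, eval_n, hx, ha, hb, hm.n,
    hm.color, Instance.colorBit, Instance.HasColor]
  split_ifs with h1 <;> simp [h1] <;> assumption

theorem holds_good {v : Expr} {a : Fin I.n} (ha : v.eval m E = a) :
    (Algo.good v).Holds m E ↔ I.Good a := by
  simp only [Algo.good, holds_and, holds_not, holds_eq, ha, eval_s, eval_t, hm.s, hm.t, holds_ex,
    eval_q, hm.q, Fin.val_inj, Instance.Good, Fin.exists_iff]
  refine and_congr Iff.rfl (and_congr Iff.rfl (exists_congr fun c => ?_))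
  rw [← exists_prop]
  refine exists_congr fun hc => ?_
  rw [holds_color hm (x := ⟨c, hc⟩) (a := I.s) (b := a) rfl (eval_s.trans hm.s)
      (show (lift 1 v).eval m (c :: E) = a from ha),
    holds_color hm (x := ⟨c, hc⟩) (a := a) (b := I.t) rfl
      (show (lift 1 v).eval m (c :: E) = a from ha) (eval_t.trans hm.t)]

theorem holds_direct : Algo.direct.Holds m E ↔ I.Direct := by
  simp only [Algo.direct, holds_ex, eval_q, hm.q, Instance.Direct, Fin.exists_iff]
  refine exists_congr fun c => ?_
  rw [← exists_prop]
  refine exists_congr fun hc => ?_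
  rw [holds_color hm (x := ⟨c, hc⟩) (a := I.s) (b := I.t) rfl (eval_s.trans hm.s)
    (eval_t.trans hm.t)]

theorem eval_digit {j r : Expr} :
    (Algo.digit j r).eval m E = digit (baseOf m) (j.eval m E) (r.eval m E) := by
  have := baseOf_pos hm
  rw [Algo.digit, eval_mod (by simpa), eval_div (by rw [eval_pow, eval_base]; positivity)]
  simp [digit]

theorem eval_selectBits {j v : Expr} : (Algo.selectBits j v).eval m E =
    selectBits (digit (baseOf m) (j.eval m E)) (v.eval m E) (numPositions m) := by
  simp only [Algo.selectBits, eval, eval_positions]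
  induction numPositions m with
  | zero => rfl
  | succ k ih =>
    dsimp only
    rw [ih, selectBits, eval_bit, eval_digit hm]
    simp

theorem eval_classOf {j v : Expr} : (Algo.classOf j v).eval m E =
    classOf (baseOf m) (numPositions m) (j.eval m E) (v.eval m E) := by
  rw [Algo.classOf, eval_digit hm, eval_add, eval_positions, eval_selectBits hm, classOf]

theorem holds_allowed {j i v : Expr} {a : Fin I.n} (ha : v.eval m E = a) :
    (Algo.allowed j i v).Holds m E ↔
      I.Allowed (fun v => classOf (baseOf m) (numPositions m) (j.eval m E) v) (i.eval m E) a := by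
  simp only [Algo.allowed, holds_and, holds_not, holds_eq, eval_s, eval_t, hm.s, hm.t,
    holds_good hm ha, eval_classOf hm, ha, Fin.val_inj, Instance.Allowed, ne_eq]

/-- The set of reached vertices is kept as a binary number, starting from `2 ^ s`. Inside the mask,
three entries (vertex, current set, round) lie above the original environment, and a fourth inside
the quantifier over the predecessor; this explains the arguments of `lift`. -/
theorem testBit_eval_reach {j i c : Expr} {x : Fin I.q} (hx : c.eval m E = x) (v : Fin I.n) :
    ((Algo.reach j i c).eval m E).testBit v = true ↔
      I.Reach (fun v => classOf (baseOf m) (numPositions m) (j.eval m E) v) (i.eval m E) x I.n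
        v := by
  simp only [Algo.reach]
  rw [eval, eval_n, hm.n]
  have : ∀ k, ∀ v : Fin I.n, Nat.testBit (Nat.rec ((pow (const 2) Algo.s).eval m E)
      (fun i_1 x ↦ (mask Algo.n ((bit (var 1) (var 0)).or ((Algo.allowed (lift 3 j) (lift 3 i)
        (var 0)).and (ex Algo.n ((bit (var 2) (var 0)).and (Algo.color (lift 4 c) (var 0)
          (var 1))))))).eval m (x :: i_1 :: E)) k) v = true ↔
      I.Reach (fun v => classOf (baseOf m) (numPositions m) (j.eval m E) v) (i.eval m E) x k v := by
    intro k
    induction k with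
    | zero =>
      intro v
      change ((pow (const 2) Algo.s).eval m E).testBit v = true ↔ v = I.s
      simp only [eval_pow, eval_const, eval_s, hm.s, Nat.testBit_two_pow,
        decide_eq_true_eq, Fin.ext_iff]
      exact eq_comm
    | succ k ih =>
      intro v
      simp only [testBit_eval_mask, eval_n, hm.n, v.2, true_and, holds_or, holds_and, holds_bit,
        holds_ex, eval_var, List.getD_cons_zero, List.getD_cons_succ, Instance.Reach, ih,
        holds_allowed hm (a := v) (v := var 0) (E := v :: _) rfl, eval_lift, List.drop_succ_cons,
        List.drop_zero, Fin.exists_iff]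
      refine or_congr Iff.rfl (and_congr Iff.rfl (exists_congr fun u => ?_))
      rw [← exists_prop]
      refine exists_congr fun hu => ?_
      rw [holds_color hm (x := x) (a := ⟨u, hu⟩) (b := v) (by simpa using hx) rfl rfl, ← ih ⟨u, hu⟩]
  exact this _ v

theorem holds_linked {j i : Expr} : (Algo.linked j i).Holds m E ↔
    I.Linked (fun v => classOf (baseOf m) (numPositions m) (j.eval m E) v) (i.eval m E) := by
  simp only [Algo.linked, holds_ex, eval_q, hm.q, eval_n, hm.n, Instance.Linked, Fin.exists_iff]
  refine exists_congr fun c => ?_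
  rw [← exists_prop]
  refine exists_congr fun hc => exists_congr fun u => ?_
  rw [← exists_prop]
  refine exists_congr fun hu => ?_
  simp only [holds_and, holds_not, holds_eq, holds_bit]
  refine and_congr ?_ (and_congr ?_ ?_)
  · simp [hm.s, Fin.ext_iff]
  · exact testBit_eval_reach hm (x := ⟨c, hc⟩) (j := lift 2 j) (i := lift 2 i) (E := u :: c :: E) rfl
      ⟨u, hu⟩
  · exact holds_color hm (x := ⟨c, hc⟩) (a := ⟨u, hu⟩) (b := I.t) rfl rfl
      (eval_t.trans hm.t)

/-- The value of `Algo.size` is the size of a vertex cover, and at most twice the minimum. -/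
theorem exists_cover : ∃ A : Finset (Fin I.n), A.card = coverSize m ∧
    (∀ u v, I.G.Adj u v → u ∈ A ∨ v ∈ A) ∧
    ∀ C : Finset (Fin I.n), (∀ u v, I.G.Adj u v → u ∈ C ∨ v ∈ C) → A.card ≤ 2 * C.card := by
  classical
  let S : ℕ → Finset (Fin I.n) := fun x => Finset.univ.filter fun v => x.testBit v = true
  have hS : ∀ x v, v ∈ S x ↔ x.testBit v = true := fun x v => by simp [S]
  -- The invariant of the greedy algorithm: at least half of the selected vertices lie in any given
  -- cover `C`.
  let Q : ℕ → Prop := fun x => ∀ C : Finset (Fin I.n), (∀ u v, I.G.Adj u v → u ∈ C ∨ v ∈ C) →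
    (S x).card ≤ 2 * (S x ∩ C).card
  -- In the environment, `x` is the current set, `v` the inner index, `y` the set at the start of
  -- the inner loop and `u` the outer index.
  have hstep : ∀ (x y : ℕ) (u v : Fin I.n), Q x →
      ∀ z, coverStep.eval m [x, v, y, u] = z →
      Q z ∧ S x ⊆ S z ∧ (I.G.Adj u v → u ∈ S z ∨ v ∈ S z) := by
    intro x y u v hQ z hz
    have hadj := holds_adj hm (u := var 3) (v := var 1) (E := [x, v, y, u]) (a := u) (b := v) rfl rfl
    rw [coverStep, eval_ite] at hz
    split_ifs at hz with h
    · simp only [holds_and, hadj, holds_not, holds_bit, eval_var, List.getD_cons_zero,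
        List.getD_cons_succ, ← hS] at h
      obtain ⟨h1, hu, hv⟩ := h
      have hz' : S z = insert u (insert v (S x)) := by
        ext w
        rw [hS, ← hz, testBit_eval_mask]
        simp [hm.n, ← hS, Fin.ext_iff]
        tauto
      refine ⟨fun C hC => ?_, ?_, fun _ => ?_⟩
      · have hne := h1.ne
        rw [hz', Finset.card_insert_of_notMem (by simp [hne, hu]), Finset.card_insert_of_notMem hv]
        have := hQ C hC
        -- Two new vertices are selected, the ends of an edge that was uncovered so far, and `C`
        -- contains one of them.
        have : (S x ∩ C).card + 1 ≤ (insert u (insert v (S x)) ∩ C).card := by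
          rcases hC u v h1 with h | h
          · rw [← Finset.card_insert_of_notMem (a := u) (by simp [hu])]
            refine Finset.card_le_card fun w hw => ?_
            simp only [Finset.mem_insert, Finset.mem_inter] at hw ⊢
            rcases hw with rfl | hw
            · exact ⟨.inl rfl, h⟩
            · exact ⟨.inr (.inr hw.1), hw.2⟩
          · rw [← Finset.card_insert_of_notMem (a := v) (by simp [hv])]
            refine Finset.card_le_card fun w hw => ?_
            simp only [Finset.mem_insert, Finset.mem_inter] at hw ⊢
            rcases hw with rfl | hw
            · exact ⟨.inr (.inl rfl), h⟩
            · exact ⟨.inr (.inr hw.1), hw.2⟩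
        omega
      · rw [hz']
        exact (Finset.subset_insert _ _).trans (Finset.subset_insert _ _)
      · rw [hz']
        exact .inl (Finset.mem_insert_self _ _)
    · obtain rfl : x = z := hz
      refine ⟨hQ, subset_rfl, fun h1 => ?_⟩
      by_contra! h2
      rw [hS, hS] at h2
      exact h (holds_and.2 ⟨hadj.2 h1, holds_and.2 ⟨by simpa using h2.1, by simpa using h2.2⟩⟩)
  let inner : ℕ → ℕ → ℕ → ℕ := fun y u k =>
    Nat.rec y (fun v x => coverStep.eval m [x, v, y, u]) k
  have hinner : ∀ (y : ℕ) (u : Fin I.n), Q y → ∀ k ≤ I.n, Q (inner y u k) ∧ S y ⊆ S (inner y u k) ∧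
      ∀ v : Fin I.n, v < k → I.G.Adj u v → u ∈ S (inner y u k) ∨ v ∈ S (inner y u k) := by
    intro y u hy k
    induction k with
    | zero => exact fun _ => ⟨hy, subset_rfl, by simp⟩
    | succ k ih =>
      intro hk
      obtain ⟨h1, h2, h3⟩ := ih (by omega)
      obtain ⟨g1, g2, g3⟩ := hstep (inner y u k) y u ⟨k, by omega⟩ h1 (inner y u (k + 1)) rfl
      refine ⟨g1, h2.trans g2, fun v hv huv => ?_⟩
      rcases Nat.lt_succ_iff_lt_or_eq.1 hv with hv | hv
      · exact (h3 v hv huv).imp (@g2 _) (@g2 _)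
      · have hv : v = ⟨k, by omega⟩ := Fin.ext hv
        rw [hv] at huv ⊢
        exact g3 huv
  let outer : ℕ → ℕ := fun k => Nat.rec 0 (fun u y => inner y u I.n) k
  have houter : ∀ k ≤ I.n, Q (outer k) ∧
      ∀ u v : Fin I.n, u < k → I.G.Adj u v → u ∈ S (outer k) ∨ v ∈ S (outer k) := by
    intro k
    induction k with
    | zero => exact fun _ => ⟨fun C _ => by simp [outer, S], by simp⟩
    | succ k ih =>
      intro hk
      obtain ⟨h1, h2⟩ := ih (by omega)
      obtain ⟨g1, g2, g3⟩ := hinner (outer k) ⟨k, by omega⟩ h1 I.n le_rfl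
      refine ⟨g1, fun u v hu huv => ?_⟩
      rcases Nat.lt_succ_iff_lt_or_eq.1 hu with hu | hu
      · exact (h2 u v hu huv).imp (@g2 _) (@g2 _)
      · have hu : u = ⟨k, by omega⟩ := Fin.ext hu
        rw [hu] at huv ⊢
        exact g3 v v.2 huv
  obtain ⟨h1, h2⟩ := houter I.n le_rfl
  refine ⟨S (outer I.n), ?_, fun u v => h2 u v u.2, fun C hC => (h1 C hC).trans ?_⟩
  · have hc : Algo.cover.eval m [] = outer I.n := by
      simp only [Algo.cover, eval, eval_n, hm.n]
      rfl
    simp only [coverSize, Algo.size, eval_count, holds_bit, eval_cover (E := _ :: _), hc, eval_n,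
      hm.n, eval_var, List.getD_cons_zero]
    rw [card_filter_range]
  · exact Nat.mul_le_mul_left _ (Finset.card_le_card Finset.inter_subset_right)

/-- The algorithm computes the optimal value. -/
theorem eval_opt : Algo.opt.eval m E = I.opt := by
  classical
  have hB := baseOf_pos hm
  let h : ℕ → Fin I.n → ℕ := fun j v => classOf (baseOf m) (numPositions m) j v
  have hval : ∀ j, I.value (h j) (coverSize m) = (if I.Direct then 1 else 0) +
      (Finset.univ.filter fun v => I.Good v).card +
      ((Finset.range (coverSize m)).filter fun i => I.Linked (h j) i).card := fun j => rfl
  have hopt : Algo.opt.eval m E = (if I.Direct then 1 else 0) +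
      ((Finset.univ.filter fun v => I.Good v).card +
      (Finset.range (baseOf m ^ numDigits m)).sup fun j =>
        ((Finset.range (coverSize m)).filter fun i => I.Linked (h j) i).card) := by
    simp only [Algo.opt, eval_add, eval_ite, eval_const, eval_count, eval_max, eval_pow, eval_base,
      eval_digits, eval_n, eval_size, hm.n]
    refine congrArg₂ _ (if_congr (holds_direct hm) rfl rfl) (congrArg₂ _ ?_ ?_)
    · rw [card_filter_range]
      congr 1
      exact Finset.filter_congr fun v _ => holds_good hm rfl
    · refine Finset.sup_congr rfl fun j _ => ?_
      congr 1
      exact Finset.filter_congr fun i _ => holds_linked hm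
  rw [hopt]
  apply le_antisymm
  · have hle : ∀ j, _ := fun j => (hval j).symm.le.trans (Instance.value_le_opt (h j) (coverSize m))
    have : ((Finset.range (baseOf m ^ numDigits m)).sup fun j =>
        ((Finset.range (coverSize m)).filter fun i => I.Linked (h j) i).card) ≤
        I.opt - ((if I.Direct then 1 else 0) + (Finset.univ.filter fun v => I.Good v).card) :=
      Finset.sup_le fun j _ => by have := hle j; omega
    -- This shows that the subtrahend above is at most `opt`, so the truncated subtraction is exact.
    have := hle 0
    omega
  · obtain ⟨A, hA1, hA2, -⟩ := exists_cover hm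
    obtain ⟨U, g, hU, hg, hopt⟩ := Instance.exists_partition A hA2
    -- `exists_classOf` speaks of natural numbers; the values of `g'` from `n` on play no role, as
    -- `U` consists of vertices.
    let g' : ℕ → ℕ := fun v => if hv : v < I.n then g ⟨v, hv⟩ else 0
    obtain ⟨j, hj, hjU⟩ := exists_classOf (b := Nat.size (m 0)) (B := baseOf m)
      (M := numPositions m) (Nat.size_pos.2 (by rw [hm.n]; exact I.s.pos)) (Nat.le_add_left _ _)
      (U.map Fin.valEmbedding) (by
        rw [Finset.card_map, numPositions, ← hA1, ← two_mul]
        exact hU) (by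
        intro v hv
        obtain ⟨w, -, rfl⟩ := Finset.mem_map.1 hv
        rw [hm.n]
        exact w.2.trans (Nat.lt_size_self _)) g' (by
        intro v hv
        obtain ⟨w, hw, rfl⟩ := Finset.mem_map.1 hv
        have := hg w hw
        simp only [g', Fin.valEmbedding_apply, w.2, dite_true, Fin.eta, baseOf]
        omega)
    have h1 := hopt (h j) fun v hv => by
      have := hjU v (Finset.mem_map.2 ⟨v, hv, rfl⟩)
      simpa [g'] using this
    rw [hA1, hval] at h1
    have h2 := Finset.le_sup (f := fun j =>
      ((Finset.range (coverSize m)).filter fun i => I.Linked (h j) i).card)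
      (Finset.mem_range.2 (show j < baseOf m ^ numDigits m from hj))
    omega

end

end MaxCDP

namespace MaxCDP

open RAM RAM.Expr

/-! ## The encoding in memory -/

theorem getD_flatMap {α β : Type*} (f : α → List β) (k : ℕ) (d : β) (l : List α)
    (hf : ∀ x ∈ l, (f x).length = k) (i : ℕ) (hi : i < l.length) (v : ℕ) (hv : v < k) :
    (l.flatMap f).getD (i * k + v) d = (f l[i]).getD v d := by
  induction l generalizing i with
  | nil => simp at hi
  | cons x l ih =>
    have hx := hf x (by simp)
    rw [List.flatMap_cons]
    cases i with
    | zero =>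
      rw [List.getD_append _ _ _ _ (by omega)]
      simp
    | succ i =>
      rw [List.getD_append_right _ _ _ _ (by rw [hx, add_mul]; omega), hx,
        show (i + 1) * k + v - k = i * k + v by rw [add_mul]; omega,
        ih (fun y hy => hf y (by simp [hy])) i (by simpa using hi)]
      simp

theorem length_flatMap_finRange {β : Type*} {n k : ℕ} {f : Fin n → List β}
    (hf : ∀ i, (f i).length = k) : ((List.finRange n).flatMap f).length = n * k := by
  simp [List.length_flatMap, hf]

theorem getD_flatMap_finRange {β : Type*} {n k : ℕ} {f : Fin n → List β}
    (hf : ∀ i, (f i).length = k) (d : β) (i : Fin n) {v : ℕ} (hv : v < k) :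
    ((List.finRange n).flatMap f).getD (i * k + v) d = (f i).getD v d := by
  rw [getD_flatMap f k d _ (fun x _ => hf x) i (by simp) v hv]
  simp

theorem length_encode (I : Instance) :
    I.encode.length = 4 + I.n * I.n + I.q * (I.n * I.n) := by
  rw [Instance.encode, List.length_append, List.length_append,
    length_flatMap_finRange (k := I.n) (by simp),
    length_flatMap_finRange (k := I.n * I.n) fun c => length_flatMap_finRange (by simp)]
  simp

/-- The appended words make room for the threshold of the decision version, which lies behind the
instance in memory. -/
theorem encodes_append (I : Instance) (y : List ℕ) :
    Encodes (fun i => (I.encode ++ y).getD i 0) I where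
  n := rfl
  q := rfl
  s := rfl
  t := rfl
  adj u v := by
    have h1 : (u : ℕ) * I.n + v < I.n * I.n := by
      calc (u : ℕ) * I.n + v < u * I.n + I.n := by omega
        _ = (u + 1) * I.n := by ring
        _ ≤ I.n * I.n := Nat.mul_le_mul_right _ u.2
    have hl := length_flatMap_finRange (n := I.n) (k := I.n)
      (f := fun u => (List.finRange I.n).map fun v => I.adjBit u v) (by simp)
    have hl' : ∀ a b c d : ℕ, 4 + ((u : ℕ) * I.n + v) < ([a, b, c, d] ++ (List.finRange I.n).flatMap
        fun u => (List.finRange I.n).map fun v => I.adjBit u v).length := fun a b c d => by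
      rw [List.length_append, hl]
      exact Nat.add_lt_add_left h1 4
    rw [List.getD_append _ _ _ _ (by rw [length_encode]; omega), Instance.encode,
      List.getD_append _ _ _ _ (hl' _ _ _ _), List.getD_append_right _ _ _ _ (by simp)]
    simp only [List.length_cons, List.length_nil, Nat.zero_add, Nat.reduceAdd,
      Nat.add_sub_cancel_left]
    rw [getD_flatMap_finRange (by simp) 0 u v.2]
    simp
  color c u v := by
    have h1 : (u : ℕ) * I.n + v < I.n * I.n := by
      calc (u : ℕ) * I.n + v < u * I.n + I.n := by omega
        _ = (u + 1) * I.n := by ring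
        _ ≤ I.n * I.n := Nat.mul_le_mul_right _ u.2
    have h2 : ((c : ℕ) * I.n + u) * I.n + v = c * (I.n * I.n) + (u * I.n + v) := by ring
    have h3 : (c : ℕ) * (I.n * I.n) + (u * I.n + v) < I.q * (I.n * I.n) := by
      calc (c : ℕ) * (I.n * I.n) + (u * I.n + v) < c * (I.n * I.n) + I.n * I.n := by omega
        _ = (c + 1) * (I.n * I.n) := by ring
        _ ≤ I.q * (I.n * I.n) := Nat.mul_le_mul_right _ c.2
    have hl := length_flatMap_finRange (n := I.n) (k := I.n)
      (f := fun u => (List.finRange I.n).map fun v => I.adjBit u v) (by simp)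
    have hl' : ∀ a₁ a₂ a₃ a₄ : ℕ, ([a₁, a₂, a₃, a₄] ++ (List.finRange I.n).flatMap
        fun u => (List.finRange I.n).map fun v => I.adjBit u v).length ≤
        4 + I.n * I.n + ((c : ℕ) * (I.n * I.n) + (u * I.n + v)) := fun _ _ _ _ => by
      rw [List.length_append, hl]
      exact Nat.le_add_right _ _
    rw [h2, List.getD_append _ _ _ _ (by rw [length_encode]; omega), Instance.encode,
      List.getD_append_right _ _ _ _ (hl' _ _ _ _)]
    simp only [List.length_append, hl, List.length_cons, List.length_nil, Nat.zero_add,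
      Nat.reduceAdd, Nat.add_sub_cancel_left]
    rw [getD_flatMap_finRange (fun c => length_flatMap_finRange (by simp)) 0 c h1,
      getD_flatMap_finRange (by simp) 0 u v.2]
    simp

theorem decideThreshold_eq (I : Instance) (r : ℕ) :
    decideThreshold (I, r) = if r ≤ I.opt then 1 else 0 := by
  classical
  rw [decideThreshold]
  refine if_congr ⟨?_, fun h => ?_⟩ rfl rfl
  · rintro ⟨S, hS, hr⟩
    exact hr.trans (I.isGreatest_opt.2 ⟨S, hS, rfl⟩)
  · obtain ⟨S, hS, hr⟩ := I.isGreatest_opt.1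
    exact ⟨S, hS, h.trans hr.ge⟩

theorem eval_decide (I : Instance) (r : ℕ) :
    Algo.decide.eval (fun i => (encodeThreshold (I, r)).getD i 0) [] = decideThreshold (I, r) := by
  have hm := encodes_append I [r]
  have hr : (I.encode ++ [r]).getD (4 + I.n * I.n + I.q * I.n * I.n) 0 = r := by
    rw [List.getD_append_right _ _ _ _ (by rw [length_encode, mul_assoc]), length_encode, mul_assoc]
    simp
  have hn := hm.n
  have hq := hm.q
  rw [decideThreshold_eq, encodeThreshold, Algo.decide, Expr.not, eval_sub, eval_sub, eval_opt hm]
  simp only [eval_const, eval_load, eval_add, eval_mul, eval_n, eval_q, hn, hq, hr]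
  -- With truncated subtraction, `1 - (r - opt)` is `1` exactly if `r ≤ opt`.
  split_ifs <;> omega

/-! ## The running time -/

/-- The number `T` bounds all quantities that control loops. -/
structure Bounds (T : ℕ) (m : ℕ → ℕ) : Prop where
  two : 2 ≤ T
  n : m 0 ≤ T
  q : m 1 ≤ T
  size : coverSize m ≤ T
  digits : numDigits m ≤ T
  base : baseOf m ≤ T
  pow : baseOf m ^ numDigits m ≤ T

section

variable {m : ℕ → ℕ} {I : Instance} {T : ℕ} {E : List ℕ} {c u v i j r : Expr}

theorem Bounds.positions (h : Bounds T m) : numPositions m ≤ T :=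
  (Nat.le_add_right _ _).trans h.digits

theorem ok_adj (h : Bounds T m) (hu : u.Ok T m E) (hv : v.Ok T m E) : (Algo.adj u v).Ok T m E :=
  ok_add trivial (ok_add (ok_mul hu trivial h.n) hv)

theorem ok_color (h : Bounds T m) (hc : c.Ok T m E) (hu : u.Ok T m E) (hv : v.Ok T m E) :
    (Algo.color c u v).Ok T m E :=
  ok_add (ok_add trivial (ok_mul trivial trivial h.n))
    (ok_add (ok_mul (ok_add (ok_mul hc trivial h.n) hu) trivial h.n) hv)

theorem ok_good (h : Bounds T m) (hv : v.Ok T m E) : (Algo.good v).Ok T m E :=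
  ok_and (ok_not (ok_eq hv trivial)) (ok_and (ok_not (ok_eq hv trivial))
    (ok_ex trivial h.q fun _ _ => ok_and (ok_color h trivial trivial hv)
      (ok_color h trivial hv trivial)))

theorem ok_direct (h : Bounds T m) : Algo.direct.Ok T m E :=
  ok_ex trivial h.q fun _ _ => ok_color h trivial trivial trivial

theorem ok_cover (h : Bounds T m) : Algo.cover.Ok T m E := by
  refine ⟨trivial, trivial, h.n, fun u hu => ⟨trivial, trivial, h.n, fun v hv => ?_⟩⟩
  have hu : u ≤ T := le_trans (le_of_lt hu) h.n
  have hv : v ≤ T := le_trans (le_of_lt hv) h.n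
  refine ⟨ok_and (ok_adj h trivial trivial) (ok_and (ok_not (ok_bit trivial trivial hu))
    (ok_not (ok_bit trivial trivial hv))), ok_mask trivial h.n h.two fun w hw => ?_, trivial⟩
  exact ok_or (ok_bit trivial trivial (le_trans (le_of_lt hw) h.n))
    (ok_or (ok_eq trivial trivial) (ok_eq trivial trivial))

theorem ok_size (h : Bounds T m) : Algo.size.Ok T m E :=
  ok_count trivial h.n fun _ hw => ok_bit (ok_cover h) trivial (le_trans (le_of_lt hw) h.n)

theorem ok_positions (h : Bounds T m) : Algo.positions.Ok T m E := by
  refine ok_mul (ok_size h) (ok_add (ok_add (ok_size h) (ok_size h)) trivial) ?_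
  simp only [eval_add, eval_size, eval_const]
  -- The multiplication loops over its second factor. That factor is at most the product unless the
  -- first one is `0`, in which case it equals `1`.
  by_cases h0 : coverSize m = 0
  · rw [h0]; exact le_trans (by norm_num) h.two
  · exact le_trans (Nat.le_mul_of_pos_left _ (Nat.pos_of_ne_zero h0)) h.positions

theorem ok_digits (h : Bounds T m) : Algo.digits.Ok T m E :=
  ok_add (ok_positions h) (ok_pow trivial (ok_positions h) (by simpa using h.positions) h.two)

theorem ok_base (h : Bounds T m) : Algo.base.Ok T m E :=
  ok_add (ok_size h) (ok_count trivial h.n fun _ hw =>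
    ok_le (ok_pow trivial trivial (le_trans (le_of_lt hw) h.n) h.two) trivial)

/-- Division loops over the dividend, so the number `j` of the partition must itself be at most `T`;
the power of the base is controlled by bounding the position by the number of digits. -/
theorem ok_digit (hm : Encodes m I) (h : Bounds T m) (hj : j.Ok T m E) (hr : r.Ok T m E)
    (hjT : j.eval m E ≤ T) (hrL : r.eval m E ≤ numDigits m) : (Algo.digit j r).Ok T m E := by
  have hB := baseOf_pos hm
  have hp : (pow Algo.base r).eval m E ≤ T := by
    rw [eval_pow, eval_base]
    exact (Nat.pow_le_pow_right hB hrL).trans h.pow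
  have hp0 : 0 < (pow Algo.base r).eval m E := by
    rw [eval_pow, eval_base]
    positivity
  refine ok_mod (ok_div hj (ok_pow (ok_base h) hr (hrL.trans h.digits) (by simpa using h.base))
    hjT hp) (ok_base h) ?_ (by simpa using h.base)
  rw [eval_div hp0]
  exact (Nat.div_le_self _ _).trans hjT

theorem ok_selectBits (hm : Encodes m I) (h : Bounds T m) (hj : j.Ok T m E) (hv : v.Ok T m E)
    (hjT : j.eval m E ≤ T) : (Algo.selectBits j v).Ok T m E := by
  refine ⟨ok_positions h, trivial, by simpa using h.positions, fun r hr => ?_⟩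
  rw [eval_positions] at hr
  refine ok_add (ok_add trivial trivial) (ok_bit hv (ok_digit hm h hj trivial hjT ?_) ?_)
  · exact hr.le.trans (Nat.le_add_right _ _)
  · rw [eval_digit hm]
    exact (Nat.mod_lt _ (baseOf_pos hm)).le.trans h.base

theorem ok_classOf (hm : Encodes m I) (h : Bounds T m) (hj : j.Ok T m E) (hv : v.Ok T m E)
    (hjT : j.eval m E ≤ T) : (Algo.classOf j v).Ok T m E := by
  refine ok_digit hm h hj (ok_add (ok_positions h) (ok_selectBits hm h hj hv hjT)) hjT ?_
  rw [eval_add, eval_positions, eval_selectBits hm]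
  exact Nat.add_le_add_left (selectBits_lt _ _ _).le _

theorem ok_allowed (hm : Encodes m I) (h : Bounds T m) (hj : j.Ok T m E) (hi : i.Ok T m E)
    (hv : v.Ok T m E) (hjT : j.eval m E ≤ T) : (Algo.allowed j i v).Ok T m E :=
  ok_and (ok_not (ok_eq hv trivial)) (ok_and (ok_not (ok_eq hv trivial))
    (ok_and (ok_not (ok_good h hv)) (ok_eq (ok_classOf hm h hj hv hjT) hi)))

/-- The sets are numbers of up to `n` bits and may far exceed `T`, but they never control a loop;
only vertices used as bit positions do. -/
theorem ok_reach (hm : Encodes m I) (h : Bounds T m) (hj : j.Ok T m E) (hi : i.Ok T m E)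
    (hc : c.Ok T m E) (hjT : j.eval m E ≤ T) : (Algo.reach j i c).Ok T m E := by
  refine ⟨trivial, ok_pow trivial trivial ?_ h.two, h.n, fun k _ =>
    ok_mask trivial h.n h.two fun v hv => ?_⟩
  · rw [eval_s, hm.s]
    exact le_trans (by rw [hm.n]; exact I.s.2.le) h.n
  · refine ok_or (ok_bit trivial trivial (le_trans (le_of_lt hv) h.n))
      (ok_and (ok_allowed hm h hj hi trivial hjT) (ok_ex trivial h.n fun u hu => ?_))
    exact ok_and (ok_bit trivial trivial (le_trans (le_of_lt hu) h.n)) (ok_color h hc trivial trivial)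

theorem ok_linked (hm : Encodes m I) (h : Bounds T m) (hj : j.Ok T m E) (hi : i.Ok T m E)
    (hjT : j.eval m E ≤ T) : (Algo.linked j i).Ok T m E :=
  ok_ex trivial h.q fun _ _ => ok_ex trivial h.n fun _ hu =>
    ok_and (ok_not (ok_eq trivial trivial)) (ok_and
      (ok_bit (ok_reach hm h hj hi trivial hjT) trivial (le_trans (le_of_lt hu) h.n))
      (ok_color h trivial trivial trivial))

theorem ok_opt (hm : Encodes m I) (h : Bounds T m) : Algo.opt.Ok T m E := by
  have hp : (pow Algo.base Algo.digits).eval m E ≤ T := by simpa using h.pow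
  refine ok_add ⟨ok_direct h, trivial, trivial⟩ (ok_add
    (ok_count trivial h.n fun _ _ => ok_good h trivial)
    (ok_max (ok_pow (ok_base h) (ok_digits h) (by simpa using h.digits) (by simpa using h.base)) hp
      fun j hj => ok_count (ok_size h) (by simpa using h.size) fun _ _ =>
        ok_linked hm h trivial trivial (hj.le.trans hp)))

theorem ok_decide (hm : Encodes m I) (h : Bounds T m) : Algo.decide.Ok T m E :=
  ok_not (ok_sub (ok_load (ok_add (ok_add trivial (ok_mul trivial trivial h.n))
    (ok_mul (ok_mul trivial trivial h.n) trivial h.n))) (ok_opt hm h))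

end

/-- A bound for the number of vertices on the paths that are not counted directly. -/
def positionsBound (N : ℕ) : ℕ := N * (N + N + 1)

/-- The number of digits of a partition. -/
def digitsBound (N : ℕ) : ℕ := positionsBound N + 2 ^ positionsBound N

/-- The dependence of the running time on the size of a vertex cover. -/
def timeFactor (N : ℕ) : ℕ := digitsBound N ^ digitsBound N * 2 ^ (N + digitsBound N + 1)

/-! ### Growth of the time bound -/

theorem digitsBound_mono : Monotone digitsBound := by
  intro a b h
  have hp : positionsBound a ≤ positionsBound b := Nat.mul_le_mul h (by omega)
  exact Nat.add_le_add hp (Nat.pow_le_pow_right (by omega) hp)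

theorem digitsBound_pos (N : ℕ) : 0 < digitsBound N :=
  Nat.add_pos_right _ (by positivity)

theorem timeFactor_mono : Monotone timeFactor := by
  intro a b h
  have hd := digitsBound_mono h
  exact Nat.mul_le_mul ((Nat.pow_le_pow_left hd _).trans (Nat.pow_le_pow_right
    (digitsBound_pos b) hd)) (Nat.pow_le_pow_right (by omega) (by omega))

/-- The power is at most the rising product `(x + 1)⋯(x + L)`, which is a factorial times a binomial
coefficient. For `x` logarithmic in the input length, the exponent `L` is thereby moved away from
the input: only `2 ^ x` depends on it. -/
theorem pow_le_pow_self_mul_two_pow (x L : ℕ) : x ^ L ≤ L ^ L * 2 ^ (x + L) :=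
  calc x ^ L ≤ (x + 1).ascFactorial L :=
        (Nat.pow_succ_le_ascFactorial x L).trans (Nat.ascFactorial_le L (by omega))
    _ = L.factorial * (x + L).choose L := Nat.ascFactorial_eq_factorial_mul_choose x L
    _ ≤ L ^ L * 2 ^ (x + L) := Nat.mul_le_mul (Nat.factorial_le_pow L) (Nat.choose_le_two_pow _ _)

theorem length_le_bitLength (x : List ℕ) : x.length ≤ bitLength x := by
  induction x with
  | nil => simp [bitLength]
  | cons a x ih => simp only [bitLength, List.map_cons, List.sum_cons, List.length_cons] at ih ⊢; omega

theorem bounds_of_encodes {m : ℕ → ℕ} {I : Instance} (hm : Encodes m I) {l : ℕ}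
    (hl : 4 + I.n * I.n + I.q * (I.n * I.n) ≤ l) :
    Bounds (timeFactor (2 * I.vertexCoverNumber) * l) m := by
  classical
  obtain ⟨A, hA, -, hC⟩ := exists_cover hm
  have hτ : coverSize m ≤ 2 * I.vertexCoverNumber := by
    obtain ⟨C, hC1, hC2⟩ := I.G.vertexCoverNum_exists
    have h := hC C.toFinset fun u v huv => by simpa using hC2 huv
    rw [hA] at h
    rwa [Instance.vertexCoverNumber, ← hC1, Set.encard_eq_coe_toFinset_card, ENat.toNat_natCast]
  have hn1 : 1 ≤ I.n := I.s.pos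
  have hnn : I.n ≤ I.n * I.n := Nat.le_mul_of_pos_left _ hn1
  have hqq : I.q ≤ I.q * (I.n * I.n) := Nat.le_mul_of_pos_right _ (by positivity)
  set N := coverSize m with hN
  have hL : numDigits m = digitsBound N := rfl
  set L := digitsBound N with hLdef
  have hL0 : 0 < L := digitsBound_pos N
  have hLL : 0 < L ^ L := by positivity
  have hle : timeFactor N * l ≤ timeFactor (2 * I.vertexCoverNumber) * l :=
    Nat.mul_le_mul_right _ (timeFactor_mono hτ)
  have hF : timeFactor N = L ^ L * 2 ^ (N + L + 1) := rfl
  have hF2 : 2 ^ (N + L + 1) ≤ timeFactor N := by rw [hF]; exact Nat.le_mul_of_pos_left _ hLL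
  have hF0 : 0 < timeFactor N := by rw [hF]; positivity
  have hF1 : N + L + 1 < timeFactor N := Nat.lt_two_pow_self.trans_le hF2
  have hFl : timeFactor N ≤ timeFactor N * l := Nat.le_mul_of_pos_right _ (by omega)
  have hlF : l ≤ timeFactor N * l := Nat.le_mul_of_pos_left _ hF0
  -- The binary length of `n` exceeds its logarithm by at most one. The resulting factor `2` is the
  -- reason for the `+ 1` in the exponent of `timeFactor`.
  have hsize : 2 ^ Nat.size (m 0) ≤ 2 * l := by
    have : 2 ^ (Nat.size (m 0) - 1) ≤ m 0 := Nat.lt_size.1 (by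
      have : 0 < Nat.size (m 0) := Nat.size_pos.2 (by rw [hm.n]; omega)
      omega)
    have h0 : 0 < Nat.size (m 0) := Nat.size_pos.2 (by rw [hm.n]; omega)
    calc 2 ^ Nat.size (m 0) = 2 * 2 ^ (Nat.size (m 0) - 1) := by
          rw [← pow_succ', Nat.sub_add_cancel h0]
      _ ≤ 2 * l := Nat.mul_le_mul_left _ (this.trans (by rw [hm.n]; omega))
  have hB : baseOf m = N + Nat.size (m 0) := rfl
  have hpow : baseOf m ^ L ≤ timeFactor N * l := by
    calc baseOf m ^ L ≤ L ^ L * 2 ^ (baseOf m + L) := pow_le_pow_self_mul_two_pow _ _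
      _ = L ^ L * 2 ^ (N + L) * 2 ^ Nat.size (m 0) := by rw [hB]; ring
      _ ≤ L ^ L * 2 ^ (N + L) * (2 * l) := Nat.mul_le_mul_left _ hsize
      _ = timeFactor N * l := by rw [hF]; ring
  constructor
  · omega
  · rw [hm.n]; omega
  · rw [hm.q]; omega
  · omega
  · omega
  · exact (Nat.le_self_pow hL0.ne' _).trans (hpow.trans hle)
  · exact hpow.trans hle

theorem primrec_timeFactor : Primrec timeFactor := by
  have hpow : Primrec₂ ((· ^ ·) : ℕ → ℕ → ℕ) := Primrec₂.unpaired'.1 Nat.Primrec.pow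
  have hpos : Primrec positionsBound :=
    Primrec.nat_mul.comp .id (Primrec.nat_add.comp (Primrec.nat_add.comp .id .id) (.const 1))
  have hdig : Primrec digitsBound :=
    Primrec.nat_add.comp hpos (hpow.comp (.const 2) hpos)
  exact Primrec.nat_mul.comp (hpow.comp hdig hdig) (hpow.comp (.const 2)
    (Primrec.nat_add.comp (Primrec.nat_add.comp .id hdig) (.const 1)))

theorem fixedParameterTractable_of_expr {α : Type} {enc : α → List ℕ} {κ F : α → ℕ} (e : Expr)
    (he : ∀ x, e.eval (fun i => (enc x).getD i 0) [] = F x)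
    (ho : ∀ x, e.Ok (timeFactor (2 * κ x) * bitLength (enc x)) (fun i => (enc x).getD i 0) [])
    (hl : ∀ x, 0 < bitLength (enc x)) : FixedParameterTractable enc κ F := by
  obtain ⟨a, k, hak⟩ := e.exists_steps_le
  have hpow : Primrec₂ ((· ^ ·) : ℕ → ℕ → ℕ) := Primrec₂.unpaired'.1 Nat.Primrec.pow
  -- The steps are at most `a * T ^ k` with `T = timeFactor (2 * κ) * |I|`, and this product splits
  -- into a function of the parameter and `|I| ^ k`.
  refine ⟨e.compile [] 0 0, fun κ => a * timeFactor (2 * κ) ^ k, k, ?_, fun x => ?_⟩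
  · exact (Primrec.nat_mul.comp (.const a) (hpow.comp (primrec_timeFactor.comp
      (Primrec.nat_mul.comp (.const 2) .id)) (.const k))).to_comp
  · obtain ⟨t, ht, h1, h2⟩ := outputsWithin_compile e (enc x) _ (ho x)
    have hF : 0 < timeFactor (2 * κ x) := by
      have := digitsBound_pos (2 * κ x)
      rw [timeFactor]
      positivity
    refine ⟨t, ht.trans ((hak _ (Nat.mul_pos hF (hl x))).trans (le_of_eq ?_)), h1, h2.trans (he x)⟩
    rw [mul_pow, mul_assoc]

end MaxCDP

/-- MaxCDP, as the problem of computing the maximum number of disjoint uni-color `st`-paths and as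
the problem of deciding whether there are at least `r` of them, is fixed-parameter tractable when
parameterized by the vertex cover number of the input graph. -/
theorem mainTheorem5 :
    RAM.FixedParameterTractable MaxCDP.Instance.encode MaxCDP.Instance.vertexCoverNumber
      MaxCDP.Instance.opt ∧
    RAM.FixedParameterTractable MaxCDP.encodeThreshold
      (fun x : MaxCDP.Instance × ℕ => x.1.vertexCoverNumber) MaxCDP.decideThreshold := by
  have hlen : ∀ I : MaxCDP.Instance, 4 + I.n * I.n + I.q * (I.n * I.n) ≤ RAM.bitLength I.encode :=
    fun I => (MaxCDP.length_encode I).ge.trans (MaxCDP.length_le_bitLength _)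
  have hlen' : ∀ x : MaxCDP.Instance × ℕ, 4 + x.1.n * x.1.n + x.1.q * (x.1.n * x.1.n) ≤
      RAM.bitLength (MaxCDP.encodeThreshold x) := fun x => by
    refine le_trans ?_ (MaxCDP.length_le_bitLength _)
    rw [MaxCDP.encodeThreshold, List.length_append, MaxCDP.length_encode]
    exact Nat.le_add_right _ _
  have hm : ∀ I : MaxCDP.Instance, MaxCDP.Encodes (fun i => I.encode.getD i 0) I := fun I => by
    simpa using MaxCDP.encodes_append I []
  constructor
  · exact MaxCDP.fixedParameterTractable_of_expr MaxCDP.Algo.opt (fun I => MaxCDP.eval_opt (hm I))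
      (fun I => MaxCDP.ok_opt (hm I) (MaxCDP.bounds_of_encodes (hm I) (hlen I)))
      fun I => by have := hlen I; omega
  · exact MaxCDP.fixedParameterTractable_of_expr MaxCDP.Algo.decide
      (fun x => MaxCDP.eval_decide x.1 x.2)
      (fun x => MaxCDP.ok_decide (MaxCDP.encodes_append x.1 [x.2])
        (MaxCDP.bounds_of_encodes (MaxCDP.encodes_append x.1 [x.2]) (hlen' x)))
      fun x => by have := hlen' x; omega
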